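/- Let $d\ge 0$ and $m\ge 1$ be integers and let $\mathcal A$ be a set of subsets of $\{1,\dots,d\}$, each of size at most $m$. On a probability space, let $\theta_{t,i}$ ($t\in\mathbb N$, $1\le i\le d$) be real random variables with $\theta_{t,i}\in[-\tfrac12,\tfrac12]$ almost surely. The outcome of action $a\in\mathcal A$ in period $t$ is $Y_{t,a}=(\theta_{t,i}: i\in a)$ and its reward is $R(Y_{t,a})=\frac1m\sum_{i\in a}\theta_{t,i}$. Let $p^*$ be a random probability distribution such that, conditionally on $p^*$, the vectors $Y_t=(Y_{t,a})_{a\in\mathcal A}$, $t\in\mathbb N$, are i.i.d. with law $p^*$, and let the optimal action $A^*\in\arg\max_{a\in\mathcal A}\mathbb E[R(Y_{t,a})\mid p^*]$ be a measurable function of $p^*$. Let $(U_t)_{t\in\mathbb N}$ be random variables such that each $U_t$ is independent of $\big((U_s)_{s\ne t},(Y_s)_{s\in\mathbb N},p^*\big)$. Let $A_t$ be the action chosen in period $t$, let $\mathcal F_t$ be the $\sigma$-algebra generated by the observations $(A_s,Y_{s,A_s})$, $s<t$, and assume that $A_t$ is measurable with respect to $\sigma(\mathcal F_t,U_t)$.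 The actions are chosen by Thompson sampling: $\mathbb P(A_t=a\mid\mathcal F_t)=\mathbb P(A^*=a\mid\mathcal F_t)$ almost surely for all $t$ and all $a\in\mathcal A$. Assume that, for each $t$, the variables $\theta_{t,1},\dots,\theta_{t,d}$ are independent conditionally on $\mathcal F_t$. For a random variable $Z$ define $$I_t(A^*;Z)=h_t-\mathbb E\Big[-\sum_{a\in\mathcal A}\mathbb P(A^*=a\mid\mathcal F_t,Z)\log\mathbb P(A^*=a\mid\mathcal F_t,Z)\,\Big|\,\mathcal F_t\Big],\qquad h_t=-\sum_{a\in\mathcal A}\mathbb P(A^*=a\mid\mathcal F_t)\log\mathbb P(A^*=a\mid\mathcal F_t),$$ and define the information ratio $$\Gamma_t=\frac{\big(\mathbb E[R(Y_{t,A^*})-R(Y_{t,A_t})\mid\mathcal F_t]\big)^2}{I_t\big(A^*;(A_t,Y_{t,A_t})\big)}\in[0,\infty],$$ where $x/0=\infty$ for $x>0$ and $0/0=0$. Then, for every $t\in\mathbb N$, $$\Gamma_t\le\frac{d}{2m^2}\quad\text{almost surely.}$$ Consequently, for every $T\in\mathbb N$, $$\mathbb E\Big[\sum_{t=1}^{T}\big(R(Y_{t,A^*})-R(Y_{t,A_t})\big)\Big]\le\frac1m\sqrt{d\,H(A^*)\,T},\qquad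 H(A^*)=-\sum_{a\in\mathcal A}\mathbb P(A^*=a)\log\mathbb P(A^*=a).$$ -/

import Mathlib

open MeasureTheory ProbabilityTheory

noncomputable section

namespace Bandit

section Information

/-- Shannon entropy `H(X) = -∑ x, ℙ(X = x) log ℙ(X = x)` (natural logarithm). -/
def entropy {Ω 𝒳 : Type*} [Fintype 𝒳] [MeasurableSpace Ω] (μ : Measure Ω) (X : Ω → 𝒳) : ℝ :=
  ∑ x, Real.negMulLog (μ.real (X ⁻¹' {x}))

/-- The entropy of the posterior law of `X` given the σ-algebra `m`, as a random variable:
`-∑ x, ℙ(X = x | m) log ℙ(X = x | m)`. -/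
def posteriorEntropy {Ω 𝒳 : Type*} [Fintype 𝒳] (m : MeasurableSpace Ω)
    [mΩ : MeasurableSpace Ω] (μ : Measure Ω) (X : Ω → 𝒳) (ω : Ω) : ℝ :=
  ∑ x, Real.negMulLog ((μ⟦X ⁻¹' {x} | m⟧) ω)

/-- The conditional entropy of `X` given `Z` under the posterior measure `ℙ(· | m)`:
`𝔼[-∑ x, ℙ(X = x | m, Z) log ℙ(X = x | m, Z) | m]`. -/
def posteriorCondEntropy {Ω 𝒳 𝒵 : Type*} [Fintype 𝒳] [MeasurableSpace 𝒵]
    (m : MeasurableSpace Ω) [mΩ : MeasurableSpace Ω] (μ : Measure Ω) (X : Ω → 𝒳) (Z : Ω → 𝒵) : Ω → ℝ :=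
  μ[posteriorEntropy (m ⊔ MeasurableSpace.comap Z inferInstance) μ X | m]

/-- The mutual information between `X` and `Z` under the posterior measure `ℙ(· | m)`. -/
def posteriorMutualInfo {Ω 𝒳 𝒵 : Type*} [Fintype 𝒳] [MeasurableSpace 𝒵]
    (m : MeasurableSpace Ω) [mΩ : MeasurableSpace Ω] (μ : Measure Ω) (X : Ω → 𝒳) (Z : Ω → 𝒵) (ω : Ω) : ℝ :=
  posteriorEntropy m μ X ω - posteriorCondEntropy m μ X Z ω

/-- The random variables `f i` are (mutually) independent conditionally on the σ-algebra `m`. -/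
def CondIndepGiven {Ω ι β : Type*} [MeasurableSpace β] (m : MeasurableSpace Ω)
    [mΩ : MeasurableSpace Ω] (μ : Measure Ω) (f : ι → Ω → β) : Prop :=
  ∀ (s : Finset ι) (B : ι → Set β), (∀ i ∈ s, MeasurableSet (B i)) →
    μ⟦⋂ i ∈ s, f i ⁻¹' B i | m⟧ =ᵐ[μ] ∏ i ∈ s, μ⟦f i ⁻¹' B i | m⟧

end Information

section Model

variable {Ω 𝒜 𝒴 𝒰 : Type*} [mΩ : MeasurableSpace Ω] [MeasurableSpace 𝒜] [MeasurableSpace 𝒴]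
  [MeasurableSpace 𝒰]

/-- What the agent sees in period `t`: the chosen action and its outcome, `(A_t, Y_{t,A_t})`. -/
def observation (Y : ℕ → Ω → 𝒜 → 𝒴) (A : ℕ → Ω → 𝒜) (t : ℕ) (ω : Ω) : 𝒜 × 𝒴 :=
  (A t ω, Y t ω (A t ω))

/-- The history `ℱ_t`, generated by the observations made before period `t`
(periods are numbered from `0`, so `ℱ_0` is trivial). -/
abbrev history (Y : ℕ → Ω → 𝒜 → 𝒴) (A : ℕ → Ω → 𝒜) (t : ℕ) : MeasurableSpace Ω :=
  ⨆ s : Fin t, MeasurableSpace.comap (observation Y A s) inferInstance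

/-- The Bayesian online decision problem: `pstar` is the random outcome distribution, `Y t ω a` is
the outcome `Y_{t,a}`, `R` the reward function, `U t` the external randomness of period `t`,
`A t` the action of period `t`, and `Astar` the optimal action. -/
structure IsBanditModel [Fintype 𝒜] (μ : Measure Ω) (pstar : Ω → ProbabilityMeasure (𝒜 → 𝒴))
    (Y : ℕ → Ω → 𝒜 → 𝒴) (R : 𝒴 → ℝ) (U : ℕ → Ω → 𝒰) (A : ℕ → Ω → 𝒜) (Astar : Ω → 𝒜) :
    Prop where
  measurable_pstar : Measurable pstar
  measurable_outcome : ∀ t, Measurable (Y t)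
  measurable_reward : Measurable R
  measurable_noise : ∀ t, Measurable (U t)
  /-- Conditionally on `pstar`, the outcome vectors `Y_t` are i.i.d. with law `pstar`. -/
  iid_outcome : ∀ (s : Finset ℕ) (B : ℕ → Set (𝒜 → 𝒴)), (∀ t ∈ s, MeasurableSet (B t)) →
    μ⟦⋂ t ∈ s, Y t ⁻¹' B t | MeasurableSpace.comap pstar inferInstance⟧
      =ᵐ[μ] fun ω => ∏ t ∈ s, (pstar ω : Measure (𝒜 → 𝒴)).real (B t)
  /-- `U_t` is independent of the other `U_s`, all the outcomes and `pstar`, jointly. -/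
  indep_noise : ∀ t, IndepFun (U t)
    (fun ω => ((fun s : {s : ℕ // s ≠ t} => U s ω), (fun s => Y s ω), pstar ω)) μ
  /-- `A_t` is random only through the history and `U_t`. -/
  measurable_action : ∀ t,
    Measurable[history Y A t ⊔ MeasurableSpace.comap (U t) inferInstance] (A t)
  /-- The optimal action is a function of the outcome distribution ... -/
  measurable_optimal : Measurable[MeasurableSpace.comap pstar inferInstance] Astar
  /-- ... that maximizes the mean reward. -/
  optimal : ∀ᵐ ω ∂μ, ∀ a, ∫ y, R (y a) ∂(pstar ω : Measure (𝒜 → 𝒴))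
    ≤ ∫ y, R (y (Astar ω)) ∂(pstar ω : Measure (𝒜 → 𝒴))

/-- Thompson sampling: given the history, the action has the posterior law of the optimal action. -/
def IsThompsonSampling (μ : Measure Ω) (Y : ℕ → Ω → 𝒜 → 𝒴) (A : ℕ → Ω → 𝒜) (Astar : Ω → 𝒜) :
    Prop :=
  ∀ (t : ℕ) (a : 𝒜), μ⟦A t ⁻¹' {a} | history Y A t⟧ =ᵐ[μ] μ⟦Astar ⁻¹' {a} | history Y A t⟧

/-- The regret incurred in period `t`. -/
def instantRegret (Y : ℕ → Ω → 𝒜 → 𝒴) (R : 𝒴 → ℝ) (A : ℕ → Ω → 𝒜) (Astar : Ω → 𝒜)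
    (t : ℕ) (ω : Ω) : ℝ :=
  R (Y t ω (Astar ω)) - R (Y t ω (A t ω))

/-- The regret over the first `T` periods. -/
def regret (Y : ℕ → Ω → 𝒜 → 𝒴) (R : 𝒴 → ℝ) (A : ℕ → Ω → 𝒜) (Astar : Ω → 𝒜)
    (T : ℕ) (ω : Ω) : ℝ :=
  ∑ t ∈ Finset.range T, instantRegret Y R A Astar t ω

/-- The information ratio `Γ_t`: squared expected regret of period `t` over the information gain
about the optimal action, both under the posterior `ℙ(· | ℱ_t)`. It takes values in `[0, ∞]`,
with `x / 0 = ∞` for `x > 0` and `0 / 0 = 0`. -/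
def informationRatio [Fintype 𝒜] (μ : Measure Ω) (Y : ℕ → Ω → 𝒜 → 𝒴) (R : 𝒴 → ℝ)
    (A : ℕ → Ω → 𝒜) (Astar : Ω → 𝒜) (t : ℕ) (ω : Ω) : ENNReal :=
  ENNReal.ofReal ((μ[instantRegret Y R A Astar t | history Y A t]) ω ^ 2) /
    ENNReal.ofReal
      (posteriorMutualInfo (history Y A t) μ Astar (observation Y A t) ω)

end Model

section SemiBandit

/-- Possible outcomes under semi-bandit feedback: a set of items with a real value for each. -/
abbrev ItemOutcome (d : ℕ) : Type := Σ a : Finset (Fin d), (a → ℝ)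

/-- `Y_{t,a} = (θ_{t,i} : i ∈ a)`. -/
def itemOutcome {Ω : Type*} {d : ℕ} {𝒜 : Finset (Finset (Fin d))} (θ : ℕ → Fin d → Ω → ℝ)
    (t : ℕ) (ω : Ω) (a : 𝒜) : ItemOutcome d :=
  ⟨a.1, fun i => θ t i ω⟩

/-- `R(v_i : i ∈ a) = m⁻¹ ∑_{i ∈ a} v_i`. -/
def itemReward {d : ℕ} (m : ℕ) (y : ItemOutcome d) : ℝ :=
  (1 / (m : ℝ)) * ∑ i, y.2 i

end SemiBandit

end Bandit

end

open Bandit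

/-
The Donsker–Varadhan variational principle bounds the information gained in period `t` from below by
any choice of test function of the observation and the optimal action. Writing `θ` for the items
and `p i` for the posterior probability that item `i` belongs to the optimal action, take the sum of
`l i * θ i - r i` over the items common to the chosen and the optimal action. The chosen action
depends only on the history and on fresh noise, so given the history it is independent of the
optimal action and of the items; as the items are conditionally independent, Hoeffding's lemma
controls the exponential moment. Thompson sampling gives the chosen action the law of the optimal
one, and `l i = lam / p i` yields `lam * C - lam ^ 2 * W / 8 ≤ I` for every real `lam`, where `C` is
the expected regret of the sums, `W` the sum of the squared widths of the items, and `I` the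
information gain. Hence `C ^ 2 ≤ W * I / 2`. The information gains telescope to at most the entropy
of the optimal action, and Cauchy–Schwarz turns the bound in each period into the regret bound.
-/

namespace Bandit

section CondProb

variable {Ω 𝒳 : Type*} {F H : MeasurableSpace Ω} [mΩ : MeasurableSpace Ω]
  {μ : Measure Ω} [IsFiniteMeasure μ]

theorem integrable_indicator_one {s : Set Ω} (hs : MeasurableSet s) :
    Integrable (s.indicator fun _ => (1 : ℝ)) μ :=
  (integrable_const _).indicator hs

theorem condProb_mem_Icc {s : Set Ω} (hs : MeasurableSet s) :
    ∀ᵐ ω ∂μ, (μ⟦s | F⟧) ω ∈ Set.Icc (0 : ℝ) 1 := by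
  by_cases hF : F ≤ mΩ
  swap
  · simp [condExp_of_not_le hF]
  have h_nonneg : (0 : Ω → ℝ) ≤ᵐ[μ] μ⟦s | F⟧ :=
    condExp_nonneg (ae_of_all _ (Set.indicator_nonneg fun _ _ => zero_le_one))
  have h_le : μ⟦s | F⟧ ≤ᵐ[μ] μ[fun _ => (1 : ℝ) | F] :=
    condExp_mono (integrable_indicator_one hs) (integrable_const _)
      (ae_of_all _ (Set.indicator_le_self' fun _ _ => zero_le_one))
  rw [condExp_const hF] at h_le
  filter_upwards [h_nonneg, h_le] with ω h0 h1 using ⟨h0, h1⟩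

theorem sum_condProb_eq_one [Fintype 𝒳] {X : Ω → 𝒳} (hF : F ≤ mΩ)
    (hX : ∀ a, MeasurableSet (X ⁻¹' {a})) :
    ∀ᵐ ω ∂μ, ∑ a, (μ⟦X ⁻¹' {a} | F⟧) ω = 1 := by
  classical
  have h_sum : (∑ a, (X ⁻¹' {a}).indicator (fun _ => (1 : ℝ))) = fun _ => 1 := by
    ext ω
    simp [Finset.sum_apply, Set.indicator_apply]
  have h := condExp_finsetSum (μ := μ) (s := Finset.univ)
    (fun a _ => integrable_indicator_one (hX a)) F
  rw [h_sum, condExp_const hF] at h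
  filter_upwards [h] with ω hω
  simpa only [Finset.sum_apply] using hω.symm

theorem condExp_indicator_of_stronglyMeasurable {s : Set Ω} (hs : MeasurableSet s) {g : Ω → ℝ}
    (hg : StronglyMeasurable[F] g) (hgi : Integrable g μ) :
    μ[s.indicator g | F] =ᵐ[μ] g * μ⟦s | F⟧ := by
  have h_indicator : g * s.indicator (fun _ => (1 : ℝ)) = s.indicator g := by
    ext ω
    by_cases h : ω ∈ s <;> simp [h]
  rw [← h_indicator]
  exact condExp_mul_of_stronglyMeasurable_left hg (h_indicator ▸ hgi.indicator hs)
    (integrable_indicator_one hs)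

theorem condExp_mul_condProb (hFH : F ≤ H) (hH : H ≤ mΩ) {s : Set Ω} (hs : MeasurableSet s)
    {g : Ω → ℝ} (hg : StronglyMeasurable[H] g) (hgi : Integrable g μ) :
    μ[g * μ⟦s | H⟧ | F] =ᵐ[μ] μ[s.indicator g | F] :=
  (condExp_congr_ae (condExp_indicator_of_stronglyMeasurable hs hg hgi).symm).trans
    (condExp_condExp_of_le hFH hH)

theorem abs_condExp_indicator_le {s : Set Ω} (hs : MeasurableSet s) {g : Ω → ℝ}
    (hgi : Integrable g μ) {C : ℝ} (hg : ∀ᵐ ω ∂μ, |g ω| ≤ C) :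
    ∀ᵐ ω ∂μ, |(μ[s.indicator g | F]) ω| ≤ C * (μ⟦s | F⟧) ω := by
  have h_le : (fun ω => |s.indicator g ω|) ≤ᵐ[μ] C • s.indicator fun _ => (1 : ℝ) := by
    filter_upwards [hg] with ω hω
    by_cases h : ω ∈ s <;> simp [h, hω]
  filter_upwards [abs_condExp_ae_le_condExp_abs (m := F) (μ := μ) (s.indicator g),
    condExp_mono (m := F) (hgi.indicator hs).abs ((integrable_indicator_one hs).smul C) h_le,
    condExp_smul C (s.indicator fun _ => (1 : ℝ)) F (μ := μ)] with ω h1 h2 h3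
  calc |(μ[s.indicator g | F]) ω| ≤ (μ[fun ω => |s.indicator g ω| | F]) ω := h1
    _ ≤ (μ[C • s.indicator fun _ => (1 : ℝ) | F]) ω := h2
    _ = C * (μ⟦s | F⟧) ω := h3

end CondProb

section AlmostEverywhere

theorem ae_forall_of_isClosed {Ω β : Type*} [MeasurableSpace Ω] {μ : Measure Ω}
    [TopologicalSpace β] [TopologicalSpace.SeparableSpace β] {p : β → Ω → Prop}
    (hp : ∀ ω, IsClosed {x | p x ω}) (h : ∀ x, ∀ᵐ ω ∂μ, p x ω) : ∀ᵐ ω ∂μ, ∀ x, p x ω := by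
  obtain ⟨s, hs, hd⟩ := TopologicalSpace.exists_countable_dense β
  filter_upwards [(ae_ball_iff hs).2 fun x _ => h x] with ω hω x
  exact closure_minimal hω (hp ω) (hd x)

end AlmostEverywhere

section Pieces

variable {Ω 𝒳 E : Type*} {A : Ω → 𝒳}

theorem comp_eq_sum_indicator [Fintype 𝒳] [AddCommMonoid E] (W : 𝒳 → Ω → E) :
    (fun ω => W (A ω) ω) = ∑ a, (A ⁻¹' {a}).indicator (W a) := by
  classical
  ext ω
  simp [Finset.sum_apply, Set.indicator_apply]

variable {F : MeasurableSpace Ω} [mΩ : MeasurableSpace Ω] {μ : Measure Ω}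
  {W : 𝒳 → Ω → ℝ}

theorem integrable_comp [Finite 𝒳] (hA : ∀ a, MeasurableSet (A ⁻¹' {a}))
    (hW : ∀ a, Integrable (W a) μ) : Integrable (fun ω => W (A ω) ω) μ := by
  have := Fintype.ofFinite 𝒳
  rw [comp_eq_sum_indicator]
  exact integrable_finsetSum' _ fun a _ => (hW a).indicator (hA a)

theorem condExp_comp [Fintype 𝒳] (hA : ∀ a, MeasurableSet (A ⁻¹' {a}))
    (hW : ∀ a, Integrable (W a) μ) :
    μ[fun ω => W (A ω) ω | F] =ᵐ[μ] ∑ a, μ[(A ⁻¹' {a}).indicator (W a) | F] := by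
  rw [comp_eq_sum_indicator]
  exact condExp_finsetSum (fun a _ => (hW a).indicator (hA a)) F

end Pieces

section PosteriorEntropy

variable {Ω 𝒳 : Type*} [Fintype 𝒳] {F H : MeasurableSpace Ω} [mΩ : MeasurableSpace Ω]
  {μ : Measure Ω} {X : Ω → 𝒳}

theorem negMulLog_le_sub_mul_log {x y : ℝ} (hx : 0 ≤ x) (hy : 0 < y) :
    Real.negMulLog x ≤ y - x * Real.log y - x := by
  obtain rfl | hx := hx.eq_or_lt
  · simpa using hy.le
  · have h_log : Real.log (y / x) ≤ y / x - 1 := Real.log_le_sub_one_of_pos (div_pos hy hx)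
    rw [Real.log_div hy.ne' hx.ne'] at h_log
    have h_mul := mul_le_mul_of_nonneg_left h_log hx.le
    rw [mul_sub, mul_sub, mul_div_cancel₀ y hx.ne'] at h_mul
    rw [Real.negMulLog_def]
    linarith

theorem abs_log_add_le {x ε : ℝ} (hx : x ∈ Set.Icc (0 : ℝ) 1) (hε : 0 < ε) :
    |Real.log (x + ε)| ≤ max |Real.log ε| |Real.log (1 + ε)| :=
  abs_le_max_abs_abs (Real.log_le_log hε (by linarith [hx.1]))
    (Real.log_le_log (by linarith [hx.1]) (by linarith [hx.2]))

theorem neg_mul_log_add_le_negMulLog {x ε : ℝ} (hx : 0 ≤ x) (hε : 0 ≤ ε) :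
    -(Real.log (x + ε) * x) ≤ Real.negMulLog x := by
  obtain rfl | hx := hx.eq_or_lt
  · simp
  · have h := mul_le_mul_of_nonneg_right (Real.log_le_log hx (le_add_of_nonneg_right hε)) hx.le
    rw [Real.negMulLog_def]
    linarith

theorem exp_log_add_ae_eq {w f : Ω → ℝ} {c : ℝ} (hw : ∀ᵐ ω ∂μ, w ω ∈ Set.Ioc 0 c) :
    (fun ω => Real.exp (Real.log (w ω) + f ω)) =ᵐ[μ] w * fun ω => Real.exp (f ω) := by
  filter_upwards [hw] with ω hω
  rw [Pi.mul_apply, Real.exp_add, Real.exp_log hω.1]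

theorem integrable_exp_log_add {w f : Ω → ℝ} {c : ℝ} (hwm : AEStronglyMeasurable w μ)
    (hw : ∀ᵐ ω ∂μ, w ω ∈ Set.Ioc 0 c) (hf : Integrable (fun ω => Real.exp (f ω)) μ) :
    Integrable (fun ω => Real.exp (Real.log (w ω) + f ω)) μ :=
  (hf.bdd_mul hwm (hw.mono fun _ hω => (Real.norm_of_nonneg hω.1.le).trans_le hω.2)).congr
    (exp_log_add_ae_eq hw).symm

theorem condExp_exp_log_add {w f : Ω → ℝ} {c : ℝ} (hF : F ≤ mΩ) (hwm : StronglyMeasurable[F] w)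
    (hw : ∀ᵐ ω ∂μ, w ω ∈ Set.Ioc 0 c) (hf : Integrable (fun ω => Real.exp (f ω)) μ) :
    μ[fun ω => Real.exp (Real.log (w ω) + f ω) | F] =ᵐ[μ]
      w * μ[fun ω => Real.exp (f ω) | F] :=
  (condExp_congr_ae (exp_log_add_ae_eq hw)).trans
    (condExp_mul_of_stronglyMeasurable_left hwm
      ((integrable_exp_log_add (hwm.mono hF).aestronglyMeasurable hw hf).congr
        (exp_log_add_ae_eq hw)) hf)

theorem entropy_nonneg [IsProbabilityMeasure μ] : 0 ≤ entropy μ X :=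
  Finset.sum_nonneg fun _ _ => Real.negMulLog_nonneg measureReal_nonneg measureReal_le_one

theorem posteriorEntropy_bot [IsProbabilityMeasure μ] (hX : ∀ a, MeasurableSet (X ⁻¹' {a})) :
    posteriorEntropy ⊥ μ X = fun _ => entropy μ X := by
  ext ω
  simp only [posteriorEntropy, entropy, condExp_bot, integral_indicator_const _ (hX _),
    smul_eq_mul, mul_one]

variable [IsFiniteMeasure μ]

theorem posteriorEntropy_nonneg (hX : ∀ a, MeasurableSet (X ⁻¹' {a})) :
    0 ≤ᵐ[μ] posteriorEntropy H μ X := by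
  filter_upwards [ae_all_iff.2 fun a => condProb_mem_Icc (F := H) (hX a)] with ω h
  exact Finset.sum_nonneg fun a _ => Real.negMulLog_nonneg (h a).1 (h a).2

theorem integrable_posteriorEntropy (hH : H ≤ mΩ) (hX : ∀ a, MeasurableSet (X ⁻¹' {a})) :
    Integrable (posteriorEntropy H μ X) μ := by
  obtain ⟨C, hC⟩ := isCompact_Icc.exists_bound_of_continuousOn
    (Real.continuous_negMulLog.continuousOn (s := Set.Icc 0 1))
  refine integrable_finsetSum _ fun a _ => Integrable.of_bound ?_ C ?_
  · exact (Real.continuous_negMulLog.comp_stronglyMeasurable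
      (stronglyMeasurable_condExp.mono hH)).aestronglyMeasurable
  · filter_upwards [condProb_mem_Icc (F := H) (hX a)] with ω hω using hC _ hω

/-- Gibbs' inequality `-q log q ≤ y - q log y - q`, at `y = exp (g a)` for the posterior weights. -/
theorem condExp_posteriorEntropy_le (hFH : F ≤ H) (hH : H ≤ mΩ)
    (hX : ∀ a, MeasurableSet (X ⁻¹' {a})) {g : 𝒳 → Ω → ℝ}
    (hg : ∀ a, StronglyMeasurable[H] (g a)) (hgi : ∀ a, Integrable (g a) μ)
    (hei : ∀ a, Integrable (fun ω => Real.exp (g a ω)) μ) :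
    ∀ᵐ ω ∂μ, (μ[posteriorEntropy H μ X | F]) ω ≤
      ∑ a, ((μ[fun ω => Real.exp (g a ω) | F]) ω - (μ[(X ⁻¹' {a}).indicator (g a) | F]) ω) - 1 := by
  have hF := hFH.trans hH
  set Q : 𝒳 → Ω → ℝ := fun a => μ⟦X ⁻¹' {a} | H⟧
  have hQ : ∀ a, ∀ᵐ ω ∂μ, Q a ω ∈ Set.Icc (0 : ℝ) 1 := fun a => condProb_mem_Icc (hX a)
  have hgQi : ∀ a, Integrable (g a * Q a) μ := fun a => by
    refine (hgi a).mul_bdd (c := 1) integrable_condExp.aestronglyMeasurable ?_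
    filter_upwards [hQ a] with ω hω
    exact (Real.norm_of_nonneg hω.1).trans_le hω.2
  have hQi : ∀ a, Integrable (Q a) μ := fun a => integrable_condExp
  set B : 𝒳 → Ω → ℝ := fun a => (fun ω => Real.exp (g a ω)) - g a * Q a - Q a
  have hBi : ∀ a, Integrable (B a) μ := fun a =>
    ((hei a).sub (hgQi a)).sub (hQi a)
  have h_gibbs : posteriorEntropy H μ X ≤ᵐ[μ] ∑ a, B a := by
    filter_upwards [ae_all_iff.2 hQ] with ω hω
    rw [Finset.sum_apply]
    refine Finset.sum_le_sum fun a _ => ?_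
    have h := negMulLog_le_sub_mul_log (hω a).1 (Real.exp_pos (g a ω))
    rwa [Real.log_exp, mul_comm] at h
  have hB : ∀ᵐ ω ∂μ, ∀ a, (μ[B a | F]) ω = (μ[fun ω => Real.exp (g a ω) | F]) ω
      - (μ[(X ⁻¹' {a}).indicator (g a) | F]) ω - (μ⟦X ⁻¹' {a} | F⟧) ω := by
    refine ae_all_iff.2 fun a => ?_
    filter_upwards [condExp_sub ((hei a).sub (hgQi a)) (hQi a) F,
      condExp_sub (hei a) (hgQi a) F, condExp_mul_condProb hFH hH (hX a) (hg a) (hgi a),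
      condExp_condExp_of_le (μ := μ) (f := (X ⁻¹' {a}).indicator fun _ => (1 : ℝ)) hFH hH]
      with ω h1 h2 h3 h4
    simp only [B, Q, Pi.sub_apply] at h1 h2 ⊢
    rw [h1, h2, h3, h4]
  filter_upwards [condExp_mono (m := F) (integrable_posteriorEntropy hH hX)
    (integrable_finsetSum' _ fun a _ => hBi a) h_gibbs,
    condExp_finsetSum (s := Finset.univ) (fun a _ => hBi a) F, hB, sum_condProb_eq_one hF hX]
    with ω h1 h2 h3 h4
  rw [h2, Finset.sum_apply] at h1
  simpa only [h3, Finset.sum_sub_distrib, h4] using h1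

/-- The prior weights enter as `P(X = a | F) + ε` so that their logarithms stay bounded; `ε`
tends to zero in `le_posteriorMutualInfo`. -/
theorem condExp_posteriorEntropy_le_add (hFH : F ≤ H) (hH : H ≤ mΩ)
    (hX : ∀ a, MeasurableSet (X ⁻¹' {a})) {f : 𝒳 → Ω → ℝ}
    (hf : ∀ a, StronglyMeasurable[H] (f a)) (hfi : ∀ a, Integrable (f a) μ)
    (hei : ∀ a, Integrable (fun ω => Real.exp (f a ω)) μ) {ε : ℝ} (hε : 0 < ε) :
    ∀ᵐ ω ∂μ, (μ[posteriorEntropy H μ X | F]) ω ≤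
      posteriorEntropy F μ X ω - ∑ a, (μ[(X ⁻¹' {a}).indicator (f a) | F]) ω - 1 +
        ∑ a, ((μ⟦X ⁻¹' {a} | F⟧) ω + ε) * (μ[fun ω => Real.exp (f a ω) | F]) ω := by
  have hF := hFH.trans hH
  set P : 𝒳 → Ω → ℝ := fun a => μ⟦X ⁻¹' {a} | F⟧
  set l : 𝒳 → Ω → ℝ := fun a ω => Real.log (P a ω + ε)
  have hP : ∀ a, ∀ᵐ ω ∂μ, P a ω ∈ Set.Icc (0 : ℝ) 1 := fun a => condProb_mem_Icc (hX a)
  have hPε : ∀ a, StronglyMeasurable[F] (fun ω => P a ω + ε) := fun a =>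
    stronglyMeasurable_condExp.add stronglyMeasurable_const
  have hl : ∀ a, StronglyMeasurable[F] (l a) := fun a =>
    (Real.measurable_log.comp (hPε a).measurable).stronglyMeasurable
  have hli : ∀ a, Integrable (l a) μ := fun a =>
    .of_bound ((hl a).mono hF).aestronglyMeasurable _
      ((hP a).mono fun ω hω => abs_log_add_le hω hε)
  have hPε_mem : ∀ a, ∀ᵐ ω ∂μ, P a ω + ε ∈ Set.Ioc 0 (1 + ε) := fun a =>
    (hP a).mono fun ω hω => ⟨by linarith [hω.1], by linarith [hω.2]⟩
  have h_pull : ∀ a, ∀ᵐ ω ∂μ, (μ[fun ω => Real.exp ((l a + f a) ω) | F]) ω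
      = (P a ω + ε) * (μ[fun ω => Real.exp (f a ω) | F]) ω := fun a =>
    condExp_exp_log_add hF (hPε a) (hPε_mem a) (hei a)
  have h_split : ∀ a, ∀ᵐ ω ∂μ, (μ[(X ⁻¹' {a}).indicator (l a + f a) | F]) ω
      = l a ω * P a ω + (μ[(X ⁻¹' {a}).indicator (f a) | F]) ω := fun a => by
    rw [Set.indicator_add']
    filter_upwards [condExp_add ((hli a).indicator (hX a)) ((hfi a).indicator (hX a)) F,
      condExp_indicator_of_stronglyMeasurable (hX a) (hl a) (hli a)] with ω h1 h2
    rw [h1, Pi.add_apply, h2, Pi.mul_apply]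
  filter_upwards [condExp_posteriorEntropy_le hFH hH hX (fun a => ((hl a).mono hFH).add (hf a))
    (fun a => (hli a).add (hfi a))
    (fun a => integrable_exp_log_add ((hPε a).mono hF).aestronglyMeasurable (hPε_mem a) (hei a)),
    ae_all_iff.2 h_pull, ae_all_iff.2 h_split, ae_all_iff.2 hP] with ω h h_pull h_split hP
  have h_entropy : -∑ a, l a ω * P a ω ≤ posteriorEntropy F μ X ω := by
    rw [← Finset.sum_neg_distrib]
    exact Finset.sum_le_sum fun a _ => neg_mul_log_add_le_negMulLog (hP a).1 hε.le
  simp only [h_pull, h_split, Finset.sum_sub_distrib, Finset.sum_add_distrib] at h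
  linarith

variable {𝒵 : Type*} [MeasurableSpace 𝒵] {Z : Ω → 𝒵}

theorem le_posteriorMutualInfo (hF : F ≤ mΩ)
    (hZ : Measurable Z) (hX : ∀ a, MeasurableSet (X ⁻¹' {a})) {f : 𝒳 → Ω → ℝ}
    (hf : ∀ a, StronglyMeasurable[F ⊔ MeasurableSpace.comap Z inferInstance] (f a))
    (hfi : ∀ a, Integrable (f a) μ) (hei : ∀ a, Integrable (fun ω => Real.exp (f a ω)) μ) :
    ∀ᵐ ω ∂μ, ∑ a, (μ[(X ⁻¹' {a}).indicator (f a) | F]) ω + 1 -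
        ∑ a, (μ⟦X ⁻¹' {a} | F⟧) ω * (μ[fun ω => Real.exp (f a ω) | F]) ω ≤
      posteriorMutualInfo F μ X Z ω := by
  filter_upwards [ae_all_iff.2 fun n : ℕ => condExp_posteriorEntropy_le_add (μ := μ)
    le_sup_left (sup_le hF hZ.comap_le) hX hf hfi hei (Nat.one_div_pos_of_nat (n := n))] with ω hω
  set E : 𝒳 → ℝ := fun a => (μ[fun ω => Real.exp (f a ω) | F]) ω
  have h_lim : Filter.Tendsto (fun n : ℕ => ∑ a, ((μ⟦X ⁻¹' {a} | F⟧) ω + 1 / ((n : ℝ) + 1)) * E a)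
      Filter.atTop (nhds (∑ a, ((μ⟦X ⁻¹' {a} | F⟧) ω + 0) * E a)) :=
    tendsto_finsetSum _ fun a _ =>
      (tendsto_one_div_add_atTop_nhds_zero_nat.const_add _).mul_const _
  have h := ge_of_tendsto' h_lim fun n => sub_le_iff_le_add'.2 (hω n)
  simp only [add_zero] at h
  rw [posteriorMutualInfo, posteriorCondEntropy]
  linarith

end PosteriorEntropy

section IndependentNoise

variable {Ω : Type*}

theorem sup_eq_generateFrom_image2_inter (F N : MeasurableSpace Ω) :
    F ⊔ N = MeasurableSpace.generateFrom
      (Set.image2 (· ∩ ·) {s | MeasurableSet[F] s} {t | MeasurableSet[N] t}) := by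
  refine le_antisymm (sup_le (fun s hs => ?_) fun t ht => ?_)
    (MeasurableSpace.generateFrom_le ?_)
  · exact .basic _ ⟨s, hs, Set.univ, .univ, Set.inter_univ s⟩
  · exact .basic _ ⟨Set.univ, .univ, t, ht, Set.univ_inter t⟩
  · rintro _ ⟨s, hs, t, ht, rfl⟩
    exact MeasurableSet.inter (le_sup_left (b := N) s hs) (le_sup_right (a := F) t ht)

theorem isPiSystem_image2_inter (F N : MeasurableSpace Ω) :
    IsPiSystem (Set.image2 (· ∩ ·) {s | MeasurableSet[F] s} {t | MeasurableSet[N] t}) := by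
  rintro _ ⟨s, hs, t, ht, rfl⟩ _ ⟨s', hs', t', ht', rfl⟩ -
  exact ⟨s ∩ s', hs.inter hs', t ∩ t', ht.inter ht', Set.inter_inter_inter_comm s s' t t'⟩

variable {F G N : MeasurableSpace Ω} [mΩ : MeasurableSpace Ω] {μ : Measure Ω}

theorem setIntegral_eq_of_isPiSystem (hF : F ≤ mΩ) {C : Set (Set Ω)}
    (h_gen : F = MeasurableSpace.generateFrom C) (hC : IsPiSystem C) (h_univ : Set.univ ∈ C)
    {f g : Ω → ℝ} (hfi : Integrable f μ) (hgi : Integrable g μ)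
    (h : ∀ s ∈ C, ∫ ω in s, f ω ∂μ = ∫ ω in s, g ω ∂μ) {s : Set Ω} (hs : MeasurableSet[F] s) :
    ∫ ω in s, f ω ∂μ = ∫ ω in s, g ω ∂μ := by
  refine MeasurableSpace.induction_on_inter h_gen hC (by simp) h (fun t ht h_eq => ?_)
    (fun t h_disj ht h_eq => ?_) s hs
  · have h_total := h _ h_univ
    rw [setIntegral_univ, setIntegral_univ] at h_total
    rw [setIntegral_compl (hF t ht) hfi, setIntegral_compl (hF t ht) hgi, h_eq, h_total]
  · rw [integral_iUnion (fun i => hF _ (ht i)) h_disj hfi.integrableOn,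
      integral_iUnion (fun i => hF _ (ht i)) h_disj hgi.integrableOn]
    exact tsum_congr h_eq

variable [IsFiniteMeasure μ]

theorem setIntegral_inter_of_indep (hG : G ≤ mΩ) (hN : N ≤ mΩ) (hNG : Indep N G μ)
    {f : Ω → ℝ} (hf : StronglyMeasurable[G] f) (hfi : Integrable f μ) {s t : Set Ω}
    (hs : MeasurableSet[G] s) (ht : MeasurableSet[N] t) :
    ∫ ω in s ∩ t, f ω ∂μ = μ.real t * ∫ ω in s, f ω ∂μ := by
  have h_const : μ[s.indicator f | N] =ᵐ[μ] fun _ => ∫ ω, s.indicator f ω ∂μ :=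
    condExp_indep_eq hG hN (hf.indicator hs) hNG.symm
  rw [Set.inter_comm, ← setIntegral_indicator (hG s hs),
    ← setIntegral_condExp hN (hfi.indicator (hG s hs)) ht,
    setIntegral_congr_ae (hN t ht) (h_const.mono fun _ h _ => h), setIntegral_const,
    integral_indicator (hG s hs), smul_eq_mul]

theorem condExp_sup_of_indep (hFG : F ≤ G) (hG : G ≤ mΩ) (hN : N ≤ mΩ) (hNG : Indep N G μ)
    {f : Ω → ℝ} (hf : StronglyMeasurable[G] f) (hfi : Integrable f μ) :
    μ[f | F ⊔ N] =ᵐ[μ] μ[f | F] := by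
  have hF := hFG.trans hG
  have hFN : F ⊔ N ≤ mΩ := sup_le hF hN
  have h_meas : StronglyMeasurable[F ⊔ N] (μ[f | F]) :=
    stronglyMeasurable_condExp.mono le_sup_left
  refine (ae_eq_condExp_of_forall_setIntegral_eq hFN hfi
    (fun _ _ _ => integrable_condExp.integrableOn) (fun u hu _ => ?_)
    h_meas.aestronglyMeasurable).symm
  refine setIntegral_eq_of_isPiSystem hFN (sup_eq_generateFrom_image2_inter F N)
    (isPiSystem_image2_inter F N) ⟨Set.univ, .univ, Set.univ, .univ, Set.univ_inter _⟩
    integrable_condExp hfi ?_ hu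
  rintro _ ⟨s, hs, t, ht, rfl⟩
  rw [setIntegral_inter_of_indep hG hN hNG (stronglyMeasurable_condExp.mono hFG)
    integrable_condExp (hFG s hs) ht, setIntegral_inter_of_indep hG hN hNG hf hfi (hFG s hs) ht,
    setIntegral_condExp hF hfi hs]

theorem condExp_indicator_of_indep (hFG : F ≤ G) (hG : G ≤ mΩ) (hN : N ≤ mΩ)
    (hNG : Indep N G μ) {s : Set Ω} (hs : MeasurableSet[F ⊔ N] s)
    {f : Ω → ℝ} (hf : StronglyMeasurable[G] f) (hfi : Integrable f μ) :
    μ[s.indicator f | F] =ᵐ[μ] μ⟦s | F⟧ * μ[f | F] := by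
  have hFN : F ⊔ N ≤ mΩ := sup_le (hFG.trans hG) hN
  calc μ[s.indicator f | F]
      =ᵐ[μ] μ[μ[s.indicator f | F ⊔ N] | F] := (condExp_condExp_of_le le_sup_left hFN).symm
    _ =ᵐ[μ] μ[s.indicator (μ[f | F]) | F] := by
        refine condExp_congr_ae ((condExp_indicator hfi hs).trans ?_)
        filter_upwards [condExp_sup_of_indep hFG hG hN hNG hf hfi] with ω hω
        by_cases h : ω ∈ s <;> simp [h, hω]
    _ =ᵐ[μ] μ[f | F] * μ⟦s | F⟧ :=
        condExp_indicator_of_stronglyMeasurable (hFN s hs) stronglyMeasurable_condExp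
          integrable_condExp
    _ = μ⟦s | F⟧ * μ[f | F] := mul_comm _ _

theorem condExp_comp_of_indep {𝒳 : Type*} [Fintype 𝒳] {A : Ω → 𝒳} (hFG : F ≤ G) (hG : G ≤ mΩ)
    (hN : N ≤ mΩ) (hNG : Indep N G μ) (hA : ∀ a, MeasurableSet[F ⊔ N] (A ⁻¹' {a}))
    {W : 𝒳 → Ω → ℝ} (hW : ∀ a, StronglyMeasurable[G] (W a)) (hWi : ∀ a, Integrable (W a) μ) :
    ∀ᵐ ω ∂μ, (μ[fun ω => W (A ω) ω | F]) ω = ∑ a, (μ⟦A ⁻¹' {a} | F⟧) ω * (μ[W a | F]) ω := by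
  have hFN : F ⊔ N ≤ mΩ := sup_le (hFG.trans hG) hN
  filter_upwards [condExp_comp (F := F) (fun a => hFN _ (hA a)) hWi,
    ae_all_iff.2 fun a => condExp_indicator_of_indep hFG hG hN hNG (hA a) (hW a) (hWi a)]
    with ω h_comp h_indicator
  rw [h_comp, Finset.sum_apply]
  exact Finset.sum_congr rfl fun a _ => h_indicator a

end IndependentNoise

section CondLaw

variable {Ω β : Type*} [MeasurableSpace β] [StandardBorelSpace β] [Nonempty β]

/-- A regular conditional law of `Y` given the σ-algebra `F`. Mathlib's `condDistrib` conditions on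
a random variable; here this is the identity, as a map into `Ω` equipped with `F`. -/
noncomputable def condLaw (F : MeasurableSpace Ω) [mΩ : MeasurableSpace Ω] (μ : Measure Ω)
    [IsFiniteMeasure μ] (Y : Ω → β) (ω : Ω) : Measure β :=
  @condDistrib Ω Ω β _ _ _ mΩ F Y id μ _ ω

variable {F : MeasurableSpace Ω} [mΩ : MeasurableSpace Ω] {μ : Measure Ω} [IsFiniteMeasure μ]
  {Y : Ω → β}

instance isProbabilityMeasure_condLaw (ω : Ω) : IsProbabilityMeasure (condLaw F μ Y ω) := by
  unfold condLaw
  infer_instance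

theorem condLaw_real_ae_eq (hF : F ≤ mΩ) (hY : Measurable Y) {B : Set β} (hB : MeasurableSet B) :
    ∀ᵐ ω ∂μ, (condLaw F μ Y ω).real B = (μ⟦Y ⁻¹' B | F⟧) ω := by
  have h := @condDistrib_ae_eq_condExp Ω Ω β _ _ _ mΩ μ _ id Y F B
    (measurable_id.mono le_rfl hF) hY hB
  rwa [MeasurableSpace.comap_id] at h

theorem condExp_comp_ae_eq_integral_condLaw (hF : F ≤ mΩ) (hY : Measurable Y) {f : β → ℝ}
    (hf : StronglyMeasurable f) (hfi : Integrable (fun ω => f (Y ω)) μ) :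
    ∀ᵐ ω ∂μ, (μ[fun ω => f (Y ω) | F]) ω = ∫ y, f y ∂condLaw F μ Y ω := by
  have h := @condExp_ae_eq_integral_condDistrib Ω Ω β ℝ _ _ _ _ mΩ μ _ id Y F _ _
    (measurable_id.mono le_rfl hF) hY.aemeasurable f hf hfi
  rwa [MeasurableSpace.comap_id] at h

theorem ae_ae_mem_condLaw (hF : F ≤ mΩ) (hY : Measurable Y) {B : Set β} (hB : MeasurableSet B)
    (h : ∀ᵐ ω ∂μ, Y ω ∈ B) : ∀ᵐ ω ∂μ, ∀ᵐ y ∂condLaw F μ Y ω, y ∈ B := by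
  have h_zero : (Y ⁻¹' Bᶜ).indicator (fun _ => (1 : ℝ)) =ᵐ[μ] 0 :=
    h.mono fun ω hω => Set.indicator_of_notMem (by simpa using hω) _
  have h_condProb := condExp_congr_ae (m := F) h_zero
  rw [condExp_zero] at h_condProb
  filter_upwards [condLaw_real_ae_eq hF hY hB.compl, h_condProb] with ω h1 h2
  rw [h2, Pi.zero_apply, measureReal_eq_zero_iff] at h1
  exact h1

end CondLaw

section Hoeffding

variable {Ω ι : Type*}

/-- Only countably many events are involved, so that the hypothesis can be checked almost surely
for a random law `ν`. -/
theorem iIndepFun_eval_of_Iic_rat {ν : Measure (ι → ℝ)} [IsProbabilityMeasure ν]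
    (h : ∀ (s : Finset ι) (q : ι → ℚ), ν (⋂ i ∈ s, (fun y => y i) ⁻¹' Set.Iic (q i : ℝ)) =
      ∏ i ∈ s, ν ((fun y => y i) ⁻¹' Set.Iic (q i : ℝ))) :
    iIndepFun (fun i (y : ι → ℝ) => y i) ν := by
  rw [iIndepFun_iff_iIndep]
  refine iIndepSets.iIndep (fun i => (measurable_pi_apply i).comap_le)
    (fun i => Set.image (Set.preimage fun y => y i) (⋃ q : ℚ, {Set.Iic (q : ℝ)}))
    (fun i => Real.isPiSystem_Iic_rat.comap _) (fun i => ?_) ?_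
  · rw [← MeasurableSpace.comap_generateFrom, ← Real.borel_eq_generateFrom_Iic_rat,
      BorelSpace.measurable_eq (α := ℝ)]
  · rw [iIndepSets_iff]
    intro s f hf
    have h_rat : ∀ i, ∃ q : ℚ, i ∈ s → (fun y : ι → ℝ => y i) ⁻¹' Set.Iic (q : ℝ) = f i := by
      intro i
      by_cases hi : i ∈ s
      · obtain ⟨t, ht, hft⟩ := hf i hi
        obtain ⟨q, rfl⟩ := Set.mem_iUnion.1 ht
        exact ⟨q, fun _ => hft⟩
      · exact ⟨0, fun h => absurd h hi⟩
    choose q hq using h_rat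
    rw [← Set.iInter₂_congr hq, h s q]
    exact Finset.prod_congr rfl fun i hi => congrArg ν (hq i hi)

theorem abs_sum_mul_le {lo hi x l : ι → ℝ} (hx : ∀ i, x i ∈ Set.Icc (lo i) (hi i)) (s : Finset ι) :
    |∑ i ∈ s, l i * x i| ≤ ∑ i ∈ s, |l i| * max |lo i| |hi i| := by
  refine (Finset.abs_sum_le_sum_abs _ _).trans (Finset.sum_le_sum fun i _ => ?_)
  rw [abs_mul]
  gcongr
  exact abs_le_max_abs_abs (hx i).1 (hx i).2

variable {F : MeasurableSpace Ω} [mΩ : MeasurableSpace Ω] {μ : Measure Ω}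
  {θ : ι → Ω → ℝ} {lo hi : ι → ℝ}

theorem integral_exp_mul_le {ν : Measure Ω} [IsProbabilityMeasure ν] {f : Ω → ℝ}
    (hf : AEMeasurable f ν) {a b : ℝ} (h : ∀ᵐ ω ∂ν, f ω ∈ Set.Icc a b) (l : ℝ) :
    ∫ ω, Real.exp (l * f ω) ∂ν ≤ Real.exp (l * ∫ ω, f ω ∂ν + l ^ 2 * (b - a) ^ 2 / 8) := by
  have h_mgf := (hasSubgaussianMGF_of_mem_Icc hf h).mgf_le l
  have h_center : mgf (fun ω => f ω - ∫ ω, f ω ∂ν) ν l =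
      Real.exp (-(l * ∫ ω, f ω ∂ν)) * ∫ ω, Real.exp (l * f ω) ∂ν := by
    rw [mgf, ← integral_const_mul]
    refine integral_congr_ae (ae_of_all _ fun ω => ?_)
    simp only [← Real.exp_add]
    ring_nf
  rw [h_center, Real.exp_neg, inv_mul_le_iff₀ (Real.exp_pos _), ← Real.exp_add] at h_mgf
  refine h_mgf.trans_eq ?_
  simp only [NNReal.coe_pow, NNReal.coe_div, coe_nnnorm, NNReal.coe_ofNat, Real.norm_eq_abs,
    div_pow, sq_abs]
  ring_nf

theorem integral_exp_sum_le {ν : Measure Ω} [IsProbabilityMeasure ν] (hθ : ∀ i, Measurable (θ i))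
    (hind : iIndepFun θ ν) (hbdd : ∀ i, ∀ᵐ ω ∂ν, θ i ω ∈ Set.Icc (lo i) (hi i))
    (s : Finset ι) (l : ι → ℝ) :
    ∫ ω, Real.exp (∑ i ∈ s, l i * θ i ω) ∂ν ≤
      Real.exp (∑ i ∈ s, (l i * ∫ ω, θ i ω ∂ν + l i ^ 2 * (hi i - lo i) ^ 2 / 8)) := by
  have h_mul : iIndepFun (fun i ω => l i * θ i ω) ν :=
    hind.comp (fun i x => l i * x) fun i => measurable_const_mul _
  have h_prod := h_mul.mgf_sum (t := 1) (fun i => (hθ i).const_mul _) s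
  simp only [mgf, one_mul, Finset.sum_apply] at h_prod
  rw [h_prod, Real.exp_sum]
  exact Finset.prod_le_prod (fun i _ => integral_nonneg fun _ => (Real.exp_pos _).le)
    fun i _ => integral_exp_mul_le (hθ i).aemeasurable (hbdd i) (l i)

variable [IsFiniteMeasure μ]

theorem ae_iIndepFun_condLaw [Finite ι] (hF : F ≤ mΩ) (hθ : ∀ i, Measurable (θ i))
    (hind : CondIndepGiven F μ θ) :
    ∀ᵐ ω ∂μ, iIndepFun (fun i (y : ι → ℝ) => y i) (condLaw F μ (fun ω i => θ i ω) ω) := by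
  have hΘ : Measurable fun ω i => θ i ω := measurable_pi_lambda _ hθ
  have h_meas : ∀ (i : ι) (q : ℚ),
      MeasurableSet ((fun y : ι → ℝ => y i) ⁻¹' Set.Iic (q : ℝ)) := fun i q =>
    measurable_pi_apply i measurableSet_Iic
  have h_prod : ∀ᵐ ω ∂μ, ∀ (s : Finset ι) (q : ι → ℚ), (condLaw F μ (fun ω i => θ i ω) ω).real
      (⋂ i ∈ s, (fun y => y i) ⁻¹' Set.Iic (q i : ℝ)) = ∏ i ∈ s,
        (condLaw F μ (fun ω i => θ i ω) ω).real ((fun y => y i) ⁻¹' Set.Iic (q i : ℝ)) := by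
    refine ae_all_iff.2 fun s => ae_all_iff.2 fun q => ?_
    filter_upwards [condLaw_real_ae_eq hF hΘ
        (Finset.measurableSet_biInter s fun i _ => h_meas i (q i)),
      ae_all_iff.2 fun i => condLaw_real_ae_eq hF hΘ (h_meas i (q i)),
      hind s (fun i => Set.Iic (q i : ℝ)) fun _ _ => measurableSet_Iic] with ω h1 h2 h3
    simp only [Set.preimage_iInter] at h1
    rw [h1, Finset.prod_congr rfl fun i _ => h2 i]
    exact h3.trans (Finset.prod_apply ω s _)
  filter_upwards [h_prod] with ω hω
  refine iIndepFun_eval_of_Iic_rat fun s q => ?_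
  rw [← ENNReal.toReal_eq_toReal_iff' (measure_ne_top _ _)
    (ENNReal.prod_ne_top fun i _ => measure_ne_top _ _), ENNReal.toReal_prod]
  exact hω s q

theorem integrable_exp_of_ae_le {f : Ω → ℝ} (hf : AEStronglyMeasurable f μ) {C : ℝ}
    (hC : ∀ᵐ ω ∂μ, f ω ≤ C) : Integrable (fun ω => Real.exp (f ω)) μ :=
  .of_bound (Real.continuous_exp.comp_aestronglyMeasurable hf) (Real.exp C)
    (hC.mono fun ω hω => by rwa [Real.norm_of_nonneg (Real.exp_pos _).le, Real.exp_le_exp])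

theorem integrable_exp_sum_mul [Countable ι] (hθ : ∀ i, Measurable (θ i))
    (hbdd : ∀ i, ∀ᵐ ω ∂μ, θ i ω ∈ Set.Icc (lo i) (hi i)) (s : Finset ι) (l : ι → ℝ) :
    Integrable (fun ω => Real.exp (∑ i ∈ s, l i * θ i ω)) μ :=
  integrable_exp_of_ae_le
    (Finset.measurable_fun_sum s fun i _ => (hθ i).const_mul _).aestronglyMeasurable
    ((ae_all_iff.2 hbdd).mono fun _ hω => (le_abs_self _).trans (abs_sum_mul_le hω s))

theorem condExp_exp_sum_le [Finite ι] (hF : F ≤ mΩ) (hθ : ∀ i, Measurable (θ i))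
    (hbdd : ∀ i, ∀ᵐ ω ∂μ, θ i ω ∈ Set.Icc (lo i) (hi i))
    (hind : CondIndepGiven F μ θ) (s : Finset ι) (l : ι → ℝ) :
    ∀ᵐ ω ∂μ, (μ[fun ω => Real.exp (∑ i ∈ s, l i * θ i ω) | F]) ω ≤
      Real.exp (∑ i ∈ s, (l i * (μ[θ i | F]) ω + l i ^ 2 * (hi i - lo i) ^ 2 / 8)) := by
  have hΘ : Measurable fun ω i => θ i ω := measurable_pi_lambda _ hθ
  have h_exp := condExp_comp_ae_eq_integral_condLaw (μ := μ) hF hΘ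
    (f := fun y => Real.exp (∑ i ∈ s, l i * y i)) (Continuous.stronglyMeasurable (by fun_prop))
    (integrable_exp_sum_mul hθ hbdd s l)
  have h_mean : ∀ᵐ ω ∂μ, ∀ i, (μ[θ i | F]) ω = ∫ y, y i ∂condLaw F μ (fun ω i => θ i ω) ω :=
    ae_all_iff.2 fun i => condExp_comp_ae_eq_integral_condLaw hF hΘ (f := fun y => y i)
      (measurable_pi_apply i).stronglyMeasurable
      (Integrable.of_mem_Icc (lo i) (hi i) (hθ i).aemeasurable (hbdd i))
  have h_mem : ∀ᵐ ω ∂μ, ∀ i, ∀ᵐ y ∂condLaw F μ (fun ω i => θ i ω) ω, y i ∈ Set.Icc (lo i) (hi i) :=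
    ae_all_iff.2 fun i => ae_ae_mem_condLaw hF hΘ
      (measurable_pi_apply i measurableSet_Icc) (hbdd i)
  filter_upwards [ae_iIndepFun_condLaw hF hθ hind, h_exp, h_mean, h_mem] with ω h1 h2 h3 h4
  simp only [h2, h3]
  exact integral_exp_sum_le measurable_pi_apply h1 h4 s l

end Hoeffding

section TiltBound

variable {𝒳 ι : Type*} [Fintype 𝒳] [DecidableEq ι] {S : 𝒳 → Finset ι}
  {α : 𝒳 → ℝ} {e : 𝒳 → ι → ℝ} {u v : ι → ℝ} {I : ℝ}

/-- The lower bound on the information gain obtained from the test function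
`∑ i ∈ S a ∩ S b, (l i * θ i - r i)`, where `a` is the optimal and `b` the chosen action: `α` is
the posterior law of either action, `e a i` and `u i` stand for the posterior means of
`𝟙 {A* = a} * θ i` and of `θ i`, and `v i` for the squared width of the range of `θ i`. -/
noncomputable def tiltBound (S : 𝒳 → Finset ι) (α : 𝒳 → ℝ) (e : 𝒳 → ι → ℝ) (u v : ι → ℝ)
    (l r : ι → ℝ) : ℝ :=
  ∑ a, ∑ b, α b * ∑ i ∈ S a ∩ S b, (l i * e a i - r i * α a) + 1 -
    ∑ a, α a * ∑ b, α b * Real.exp (∑ i ∈ S a ∩ S b, (l i * u i + l i ^ 2 * v i / 8 - r i))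

theorem continuous_tiltBound :
    Continuous fun x : (ι → ℝ) × (ι → ℝ) => tiltBound S α e u v x.1 x.2 := by
  unfold tiltBound
  fun_prop

variable [Fintype ι]

theorem sum_sum_mul_sum_inter (S : 𝒳 → Finset ι) (α : 𝒳 → ℝ) (x : 𝒳 → ι → ℝ) :
    ∑ a, ∑ b, α b * ∑ i ∈ S a ∩ S b, x a i =
      ∑ i, (∑ b with i ∈ S b, α b) * ∑ a with i ∈ S a, x a i := by
  have h_term : ∀ a b, α b * ∑ i ∈ S a ∩ S b, x a i =
      ∑ i, (if i ∈ S b then α b else 0) * if i ∈ S a then x a i else 0 := by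
    intro a b
    rw [← Finset.univ_inter (S a ∩ S b), ← Finset.sum_ite_mem, Finset.mul_sum]
    refine Finset.sum_congr rfl fun i _ => ?_
    by_cases ha : i ∈ S a <;> by_cases hb : i ∈ S b <;> simp [ha, hb]
  simp only [h_term, Finset.sum_filter, Finset.sum_mul_sum]
  rw [Finset.sum_comm_cycle]
  exact Finset.sum_congr rfl fun i _ => Finset.sum_comm

theorem le_mul_tilted_of_div {p c w : ℝ} (hw : 0 ≤ w) (hc : p = 0 → c = 0) (x : ℝ) :
    x * c - x ^ 2 * w / 8 ≤ p * (x / p * c - (x / p) ^ 2 * w / 8 * p) := by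
  by_cases hp : p = 0
  · have := mul_nonneg (sq_nonneg x) hw
    simp only [hc hp, hp, mul_zero, zero_mul]
    linarith
  · refine le_of_eq ?_
    field_simp

/-- The penalty `r i = l i * u i + l i ^ 2 * v i / 8` makes every exponent in `tiltBound` vanish,
and `l i = x / p i`, with `p i` the probability that item `i` is chosen, balances the items. -/
theorem mul_sum_sub_le_of_tiltBound_le (hα : ∀ a, 0 ≤ α a) (hα1 : ∑ a, α a = 1)
    (he : ∀ a i, α a = 0 → e a i = 0) (hv : ∀ i, 0 ≤ v i)
    (h : ∀ l r, tiltBound S α e u v l r ≤ I) (x : ℝ) :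
    x * ∑ a, ∑ i ∈ S a, (e a i - α a * u i) - x ^ 2 * (∑ i, v i) / 8 ≤ I := by
  set p : ι → ℝ := fun i => ∑ b with i ∈ S b, α b with hp
  set c : ι → ℝ := fun i => ∑ a with i ∈ S a, (e a i - α a * u i) with hc
  have h_swap : ∑ a, ∑ i ∈ S a, (e a i - α a * u i) = ∑ i, c i := by
    simp only [hc, Finset.sum_filter]
    rw [Finset.sum_comm]
    exact Finset.sum_congr rfl fun a _ => by
      rw [Finset.sum_ite_mem, Finset.univ_inter]
  have h_zero : ∀ i, p i = 0 → c i = 0 := fun i hi => Finset.sum_eq_zero fun a ha => by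
    have hαa := (Finset.sum_eq_zero_iff_of_nonneg fun b _ => hα b).1 hi a ha
    rw [he a i hαa, hαa, zero_mul, sub_zero]
  have h_inner : ∀ i (l r : ℝ), r = l * u i + l ^ 2 * v i / 8 →
      ∑ a with i ∈ S a, (l * e a i - r * α a) = l * c i - l ^ 2 * v i / 8 * p i := by
    rintro i l _ rfl
    simp only [hc, hp, Finset.mul_sum, ← Finset.sum_sub_distrib]
    exact Finset.sum_congr rfl fun a _ => by ring
  have h_tilt := h (fun i => x / p i) fun i => x / p i * u i + (x / p i) ^ 2 * v i / 8
  simp only [tiltBound, sub_self, Finset.sum_const_zero, Real.exp_zero, mul_one, hα1,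
    add_sub_cancel_right, sum_sum_mul_sum_inter, h_inner _ _ _ rfl] at h_tilt
  calc x * ∑ a, ∑ i ∈ S a, (e a i - α a * u i) - x ^ 2 * (∑ i, v i) / 8
      = ∑ i, (x * c i - x ^ 2 * v i / 8) := by
        rw [h_swap, Finset.sum_sub_distrib, Finset.mul_sum, Finset.mul_sum, Finset.sum_div]
    _ ≤ ∑ i, p i * (x / p i * c i - (x / p i) ^ 2 * v i / 8 * p i) :=
        Finset.sum_le_sum fun i _ => le_mul_tilted_of_div (hv i) (h_zero i) x
    _ ≤ I := h_tilt

theorem sq_sum_sub_le_of_tiltBound_le (hα : ∀ a, 0 ≤ α a) (hα1 : ∑ a, α a = 1)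
    (he : ∀ a i, α a = 0 → e a i = 0) (hv : ∀ i, 0 ≤ v i)
    (h : ∀ l r, tiltBound S α e u v l r ≤ I) :
    (∑ a, ∑ i ∈ S a, (e a i - α a * u i)) ^ 2 ≤ (∑ i, v i) / 2 * I := by
  have h_discrim := discrim_le_zero (a := (∑ i, v i) / 8)
    (b := -∑ a, ∑ i ∈ S a, (e a i - α a * u i)) (c := I) fun x => by
      linarith [mul_sum_sub_le_of_tiltBound_le hα hα1 he hv h x]
  rw [discrim] at h_discrim
  linarith

end TiltBound

section ConditionalRegret

variable {Ω 𝒳 ι : Type*} {F G N : MeasurableSpace Ω} [mΩ : MeasurableSpace Ω]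
  {μ : Measure Ω} {S : 𝒳 → Finset ι} {θ : ι → Ω → ℝ} {A X : Ω → 𝒳}

theorem integrable_sum_sub_sum [Finite 𝒳] (hA : ∀ a, MeasurableSet (A ⁻¹' {a}))
    (hX : ∀ a, MeasurableSet (X ⁻¹' {a})) (hθ : ∀ i, Integrable (θ i) μ) :
    Integrable (fun ω => ∑ i ∈ S (X ω), θ i ω - ∑ i ∈ S (A ω), θ i ω) μ :=
  (integrable_comp hX fun a => integrable_finsetSum (S a) fun i _ => hθ i).sub
    (integrable_comp hA fun a => integrable_finsetSum (S a) fun i _ => hθ i)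

variable [Fintype 𝒳] [IsFiniteMeasure μ]

theorem condExp_sum_sub_sum (hFG : F ≤ G) (hG : G ≤ mΩ) (hN : N ≤ mΩ) (hNG : Indep N G μ)
    (hA : ∀ b, MeasurableSet[F ⊔ N] (A ⁻¹' {b})) (hX : ∀ a, MeasurableSet (X ⁻¹' {a}))
    (hTS : ∀ b, μ⟦A ⁻¹' {b} | F⟧ =ᵐ[μ] μ⟦X ⁻¹' {b} | F⟧)
    (hθG : ∀ b, ∀ i ∈ S b, Measurable[G] (θ i)) (hθ : ∀ i, Integrable (θ i) μ) :
    ∀ᵐ ω ∂μ, (μ[fun ω => ∑ i ∈ S (X ω), θ i ω - ∑ i ∈ S (A ω), θ i ω | F]) ω =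
      ∑ a, ∑ i ∈ S a, ((μ[(X ⁻¹' {a}).indicator (θ i) | F]) ω -
        (μ⟦X ⁻¹' {a} | F⟧) ω * (μ[θ i | F]) ω) := by
  have h_sum : ∀ a, Integrable (fun ω => ∑ i ∈ S a, θ i ω) μ := fun a =>
    integrable_finsetSum _ fun i _ => hθ i
  have h_indicator : ∀ a, (X ⁻¹' {a}).indicator (∑ i ∈ S a, θ i) =
      ∑ i ∈ S a, (X ⁻¹' {a}).indicator (θ i) := fun a => by
    ext ω
    by_cases h : ω ∈ X ⁻¹' {a} <;> simp [h, Finset.sum_apply]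
  have h_fun : ∀ a, (fun ω => ∑ i ∈ S a, θ i ω) = ∑ i ∈ S a, θ i := fun a => by
    ext ω
    rw [Finset.sum_apply]
  have hA_pre : ∀ b, MeasurableSet (A ⁻¹' {b}) := fun b => sup_le (hFG.trans hG) hN _ (hA b)
  filter_upwards [condExp_sub (integrable_comp hX h_sum) (integrable_comp hA_pre h_sum) F,
    condExp_comp (F := F) hX h_sum,
    condExp_comp_of_indep hFG hG hN hNG hA (W := fun b ω => ∑ i ∈ S b, θ i ω)
      (fun b => Finset.stronglyMeasurable_fun_sum _ fun i hi => (hθG b i hi).stronglyMeasurable)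
      h_sum,
    ae_all_iff.2 fun a =>
      condExp_finsetSum (fun i (_ : i ∈ S a) => (hθ i).indicator (hX a)) F,
    ae_all_iff.2 fun a => condExp_finsetSum (fun i (_ : i ∈ S a) => hθ i) F,
    ae_all_iff.2 hTS] with ω h_sub h_X h_A h_X_sum h_A_sum h_TS
  refine h_sub.trans ?_
  simp only [Pi.sub_apply, h_X, h_A, h_indicator, h_fun, h_X_sum, h_A_sum, h_TS,
    Finset.sum_apply, Finset.mul_sum, Finset.sum_sub_distrib]

end ConditionalRegret

section OnePeriod

variable {Ω 𝒳 ι : Type*} [DecidableEq ι] {S : 𝒳 → Finset ι} {θ : ι → Ω → ℝ} {A X : Ω → 𝒳}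

/-- The test function for the mutual information between the optimal action `a` and the
observation of action `b`: an affine function of the items common to both. -/
noncomputable def tilt (S : 𝒳 → Finset ι) (θ : ι → Ω → ℝ) (l r : ι → ℝ) (a b : 𝒳) (ω : Ω) : ℝ :=
  ∑ i ∈ S a ∩ S b, (l i * θ i ω - r i)

theorem exp_tilt_eq (l r : ι → ℝ) (a b : 𝒳) :
    (fun ω => Real.exp (tilt S θ l r a b ω)) = Real.exp (-∑ i ∈ S a ∩ S b, r i) •
      fun ω => Real.exp (∑ i ∈ S a ∩ S b, l i * θ i ω) := by
  ext ω
  rw [tilt, Finset.sum_sub_distrib, sub_eq_neg_add, Real.exp_add, Pi.smul_apply, smul_eq_mul]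

theorem indicator_tilt_eq (l r : ι → ℝ) (a b : 𝒳) (s : Set Ω) :
    s.indicator (tilt S θ l r a b) = ∑ i ∈ S a ∩ S b,
      (l i • s.indicator (θ i) - r i • s.indicator fun _ => (1 : ℝ)) := by
  ext ω
  by_cases h : ω ∈ s <;> simp [tilt, h, Finset.sum_apply]

theorem stronglyMeasurable_tilt {m : MeasurableSpace Ω} {b : 𝒳}
    (hθ : ∀ i ∈ S b, Measurable[m] (θ i)) (l r : ι → ℝ) (a : 𝒳) :
    StronglyMeasurable[m] (tilt S θ l r a b) :=
  Finset.stronglyMeasurable_fun_sum _ fun i hi =>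
    ((hθ i (Finset.mem_inter.1 hi).2).stronglyMeasurable.const_mul _).sub stronglyMeasurable_const

theorem stronglyMeasurable_tilt_comp [MeasurableSpace 𝒳] [DiscreteMeasurableSpace 𝒳]
    {m : MeasurableSpace Ω} (hA : Measurable[m] A)
    (hθ : ∀ i, Measurable[m] fun ω => if i ∈ S (A ω) then θ i ω else 0) (l r : ι → ℝ) (a : 𝒳) :
    StronglyMeasurable[m] fun ω => tilt S θ l r a (A ω) ω := by
  have h_eq : (fun ω => tilt S θ l r a (A ω) ω) = fun ω => ∑ i ∈ S a,
      (l i * (if i ∈ S (A ω) then θ i ω else 0) - if i ∈ S (A ω) then r i else 0) := by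
    ext ω
    rw [tilt, ← Finset.sum_ite_mem]
    exact Finset.sum_congr rfl fun i _ => by split_ifs <;> simp
  rw [h_eq]
  refine Finset.stronglyMeasurable_fun_sum _ fun i _ =>
    ((hθ i).stronglyMeasurable.const_mul _).sub (Measurable.stronglyMeasurable ?_)
  exact (Measurable.of_discrete (f := fun b => if i ∈ S b then r i else 0)).comp hA

variable {F G N : MeasurableSpace Ω} [mΩ : MeasurableSpace Ω] {μ : Measure Ω}
  [IsFiniteMeasure μ] {lo hi : ι → ℝ}

theorem integrable_tilt (hθ : ∀ i, Integrable (θ i) μ) (l r : ι → ℝ) (a b : 𝒳) :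
    Integrable (tilt S θ l r a b) μ :=
  integrable_finsetSum _ fun i _ => ((hθ i).const_mul _).sub (integrable_const _)

theorem integrable_exp_tilt [Countable ι] (hθ : ∀ i, Measurable (θ i))
    (hbdd : ∀ i, ∀ᵐ ω ∂μ, θ i ω ∈ Set.Icc (lo i) (hi i)) (l r : ι → ℝ) (a b : 𝒳) :
    Integrable (fun ω => Real.exp (tilt S θ l r a b ω)) μ := by
  rw [exp_tilt_eq]
  exact (integrable_exp_sum_mul hθ hbdd _ l).smul _

theorem condExp_indicator_tilt (hθ : ∀ i, Integrable (θ i) μ) {s : Set Ω} (hs : MeasurableSet s)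
    (l r : ι → ℝ) (a b : 𝒳) :
    ∀ᵐ ω ∂μ, (μ[s.indicator (tilt S θ l r a b) | F]) ω = ∑ i ∈ S a ∩ S b,
      (l i * (μ[s.indicator (θ i) | F]) ω - r i * (μ⟦s | F⟧) ω) := by
  have h_left : ∀ i, Integrable (l i • s.indicator (θ i)) μ := fun i =>
    ((hθ i).indicator hs).smul _
  have h_right : ∀ i, Integrable (r i • s.indicator fun _ => (1 : ℝ)) μ := fun i =>
    (integrable_indicator_one hs).smul _
  have h_term : ∀ i ∈ S a ∩ S b,
      μ[l i • s.indicator (θ i) - r i • s.indicator (fun _ => (1 : ℝ)) | F] =ᵐ[μ]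
        l i • μ[s.indicator (θ i) | F] - r i • μ⟦s | F⟧ := fun i _ =>
    (condExp_sub (h_left i) (h_right i) F).trans ((condExp_smul _ _ F).sub (condExp_smul _ _ F))
  filter_upwards [condExp_finsetSum (μ := μ) (s := S a ∩ S b)
      (fun i _ => (h_left i).sub (h_right i)) F, (Finset.eventually_all _).2 h_term]
    with ω h_sum h_terms
  rw [indicator_tilt_eq, h_sum, Finset.sum_apply]
  exact Finset.sum_congr rfl h_terms

theorem condExp_exp_tilt_le [Finite ι] (hF : F ≤ mΩ) (hθ : ∀ i, Measurable (θ i))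
    (hbdd : ∀ i, ∀ᵐ ω ∂μ, θ i ω ∈ Set.Icc (lo i) (hi i)) (hind : CondIndepGiven F μ θ)
    (l r : ι → ℝ) (a b : 𝒳) :
    ∀ᵐ ω ∂μ, (μ[fun ω => Real.exp (tilt S θ l r a b ω) | F]) ω ≤ Real.exp
      (∑ i ∈ S a ∩ S b, (l i * (μ[θ i | F]) ω + l i ^ 2 * (hi i - lo i) ^ 2 / 8 - r i)) := by
  rw [exp_tilt_eq]
  filter_upwards [condExp_smul (μ := μ) (Real.exp (-∑ i ∈ S a ∩ S b, r i))
      (fun ω => Real.exp (∑ i ∈ S a ∩ S b, l i * θ i ω)) F,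
    condExp_exp_sum_le hF hθ hbdd hind (S a ∩ S b) l] with ω h_smul h_le
  rw [h_smul, Finset.sum_sub_distrib, sub_eq_neg_add, Real.exp_add]
  exact mul_le_mul_of_nonneg_left h_le (Real.exp_pos _).le

variable [Fintype 𝒳]

theorem condExp_indicator_tilt_comp (hFG : F ≤ G) (hG : G ≤ mΩ) (hN : N ≤ mΩ)
    (hNG : Indep N G μ) (hA : ∀ b, MeasurableSet[F ⊔ N] (A ⁻¹' {b}))
    (hθG : ∀ b, ∀ i ∈ S b, Measurable[G] (θ i)) (hθ : ∀ i, Integrable (θ i) μ) {s : Set Ω}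
    (hs : MeasurableSet[G] s) (l r : ι → ℝ) (a : 𝒳) :
    ∀ᵐ ω ∂μ, (μ[s.indicator fun ω => tilt S θ l r a (A ω) ω | F]) ω =
      ∑ b, (μ⟦A ⁻¹' {b} | F⟧) ω * ∑ i ∈ S a ∩ S b,
        (l i * (μ[s.indicator (θ i) | F]) ω - r i * (μ⟦s | F⟧) ω) := by
  filter_upwards [condExp_comp_of_indep (W := fun b => s.indicator (tilt S θ l r a b)) hFG hG hN
      hNG hA (fun b => (stronglyMeasurable_tilt (hθG b) l r a).indicator hs)
      (fun b => (integrable_tilt hθ l r a b).indicator (hG s hs)),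
    ae_all_iff.2 fun b => condExp_indicator_tilt (S := S) (F := F) hθ (hG s hs) l r a b]
    with ω h_comp h_tilt
  simp only [h_tilt] at h_comp
  exact h_comp

theorem condExp_exp_tilt_comp_le [Finite ι] (hFG : F ≤ G) (hG : G ≤ mΩ) (hN : N ≤ mΩ)
    (hNG : Indep N G μ) (hA : ∀ b, MeasurableSet[F ⊔ N] (A ⁻¹' {b}))
    (hθG : ∀ b, ∀ i ∈ S b, Measurable[G] (θ i)) (hθ : ∀ i, Measurable (θ i))
    (hbdd : ∀ i, ∀ᵐ ω ∂μ, θ i ω ∈ Set.Icc (lo i) (hi i)) (hind : CondIndepGiven F μ θ)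
    (l r : ι → ℝ) (a : 𝒳) :
    ∀ᵐ ω ∂μ, (μ[fun ω => Real.exp (tilt S θ l r a (A ω) ω) | F]) ω ≤
      ∑ b, (μ⟦A ⁻¹' {b} | F⟧) ω * Real.exp
        (∑ i ∈ S a ∩ S b, (l i * (μ[θ i | F]) ω + l i ^ 2 * (hi i - lo i) ^ 2 / 8 - r i)) := by
  have hF := hFG.trans hG
  filter_upwards [condExp_comp_of_indep (W := fun b ω => Real.exp (tilt S θ l r a b ω)) hFG hG hN
      hNG hA (fun b => Real.continuous_exp.comp_stronglyMeasurable
        (stronglyMeasurable_tilt (hθG b) l r a)) (integrable_exp_tilt hθ hbdd l r a),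
    ae_all_iff.2 fun b => condExp_exp_tilt_le (S := S) hF hθ hbdd hind l r a b,
    ae_all_iff.2 fun b => condProb_mem_Icc (F := F) (sup_le hF hN _ (hA b))]
    with ω h_comp h_tilt h_prob
  rw [h_comp]
  exact Finset.sum_le_sum fun b _ => mul_le_mul_of_nonneg_left (h_tilt b) (h_prob b).1

variable [MeasurableSpace 𝒳] [DiscreteMeasurableSpace 𝒳] {𝒵 : Type*}
  [MeasurableSpace 𝒵] {Z : Ω → 𝒵}

theorem tiltBound_le_posteriorMutualInfo [Finite ι] (hFG : F ≤ G) (hG : G ≤ mΩ)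
    (hN : N ≤ mΩ) (hNG : Indep N G μ) (hA : Measurable[F ⊔ N] A) (hX : Measurable[G] X)
    (hTS : ∀ b, μ⟦A ⁻¹' {b} | F⟧ =ᵐ[μ] μ⟦X ⁻¹' {b} | F⟧)
    (hθG : ∀ b, ∀ i ∈ S b, Measurable[G] (θ i)) (hθ : ∀ i, Measurable (θ i))
    (hbdd : ∀ i, ∀ᵐ ω ∂μ, θ i ω ∈ Set.Icc (lo i) (hi i)) (hind : CondIndepGiven F μ θ)
    (hZ : Measurable Z) (hAZ : Measurable[.comap Z inferInstance] A)
    (hθZ : ∀ i, Measurable[.comap Z inferInstance] fun ω => if i ∈ S (A ω) then θ i ω else 0)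
    (l r : ι → ℝ) :
    ∀ᵐ ω ∂μ, tiltBound S (fun a => (μ⟦X ⁻¹' {a} | F⟧) ω)
      (fun a i => (μ[(X ⁻¹' {a}).indicator (θ i) | F]) ω) (fun i => (μ[θ i | F]) ω)
      (fun i => (hi i - lo i) ^ 2) l r ≤ posteriorMutualInfo F μ X Z ω := by
  have hF := hFG.trans hG
  have hA' : ∀ b, MeasurableSet[F ⊔ N] (A ⁻¹' {b}) := fun b => hA (.singleton b)
  have hX' : ∀ a, MeasurableSet[G] (X ⁻¹' {a}) := fun a => hX (.singleton a)
  have hA_pre : ∀ b, MeasurableSet (A ⁻¹' {b}) := fun b => sup_le hF hN _ (hA' b)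
  have hθ_int : ∀ i, Integrable (θ i) μ := fun i =>
    Integrable.of_mem_Icc (lo i) (hi i) (hθ i).aemeasurable (hbdd i)
  filter_upwards [le_posteriorMutualInfo hF hZ (fun a => hG _ (hX' a))
      (fun a => (stronglyMeasurable_tilt_comp hAZ hθZ l r a).mono le_sup_right)
      (fun a => integrable_comp hA_pre (integrable_tilt hθ_int l r a))
      (fun a => integrable_comp hA_pre (integrable_exp_tilt hθ hbdd l r a)),
    ae_all_iff.2 fun a =>
      condExp_indicator_tilt_comp hFG hG hN hNG hA' hθG hθ_int (hX' a) l r a,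
    ae_all_iff.2 fun a => condExp_exp_tilt_comp_le hFG hG hN hNG hA' hθG hθ hbdd hind l r a,
    ae_all_iff.2 hTS, ae_all_iff.2 fun a => condProb_mem_Icc (F := F) (hG _ (hX' a))]
    with ω h_info h_lin h_exp h_TS h_prob
  refine le_trans ?_ h_info
  simp only [h_TS] at h_lin h_exp
  simp only [tiltBound, h_lin]
  gcongr with a
  · exact (h_prob a).1
  · exact h_exp a

theorem sq_condExp_sum_sub_sum_le [Fintype ι] (hFG : F ≤ G) (hG : G ≤ mΩ) (hN : N ≤ mΩ)
    (hNG : Indep N G μ) (hA : Measurable[F ⊔ N] A) (hX : Measurable[G] X)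
    (hTS : ∀ b, μ⟦A ⁻¹' {b} | F⟧ =ᵐ[μ] μ⟦X ⁻¹' {b} | F⟧)
    (hθG : ∀ b, ∀ i ∈ S b, Measurable[G] (θ i)) (hθ : ∀ i, Measurable (θ i))
    (hbdd : ∀ i, ∀ᵐ ω ∂μ, θ i ω ∈ Set.Icc (lo i) (hi i)) (hind : CondIndepGiven F μ θ)
    (hZ : Measurable Z) (hAZ : Measurable[.comap Z inferInstance] A)
    (hθZ : ∀ i, Measurable[.comap Z inferInstance] fun ω => if i ∈ S (A ω) then θ i ω else 0) :
    ∀ᵐ ω ∂μ, (μ[fun ω => ∑ i ∈ S (X ω), θ i ω - ∑ i ∈ S (A ω), θ i ω | F]) ω ^ 2 ≤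
      (∑ i, (hi i - lo i) ^ 2) / 2 * posteriorMutualInfo F μ X Z ω := by
  have hF := hFG.trans hG
  have hX_pre : ∀ a, MeasurableSet (X ⁻¹' {a}) := fun a => hG _ (hX (.singleton a))
  have hθ_int : ∀ i, Integrable (θ i) μ := fun i =>
    Integrable.of_mem_Icc (lo i) (hi i) (hθ i).aemeasurable (hbdd i)
  have h_abs : ∀ i, ∀ᵐ ω ∂μ, |θ i ω| ≤ max |lo i| |hi i| := fun i =>
    (hbdd i).mono fun ω hω => abs_le_max_abs_abs hω.1 hω.2
  have h_bound := fun x : (ι → ℝ) × (ι → ℝ) => tiltBound_le_posteriorMutualInfo hFG hG hN hNG hA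
    hX hTS hθG hθ hbdd hind hZ hAZ hθZ x.1 x.2
  filter_upwards [
    condExp_sum_sub_sum hFG hG hN hNG (fun b => hA (.singleton b)) hX_pre hTS hθG hθ_int,
    ae_forall_of_isClosed (fun ω => isClosed_le continuous_tiltBound continuous_const) h_bound,
    sum_condProb_eq_one (μ := μ) hF hX_pre,
    ae_all_iff.2 fun a => condProb_mem_Icc (F := F) (hX_pre a),
    ae_all_iff.2 fun a => ae_all_iff.2 fun i =>
      abs_condExp_indicator_le (F := F) (hX_pre a) (hθ_int i) (h_abs i)]
    with ω h_regret h_tilt h_one h_prob h_dom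
  rw [h_regret]
  refine sq_sum_sub_le_of_tiltBound_le (fun a => (h_prob a).1) h_one (fun a i hi => ?_)
    (fun i => sq_nonneg _) fun l r => h_tilt (l, r)
  have h_le := h_dom a i
  rwa [hi, mul_zero, abs_nonpos_iff] at h_le

end OnePeriod

section History

variable {Ω 𝒜 𝒴 : Type*} [MeasurableSpace 𝒜] [MeasurableSpace 𝒴] {Y : ℕ → Ω → 𝒜 → 𝒴}
  {A : ℕ → Ω → 𝒜}

theorem measurable_observation [Countable 𝒜] [MeasurableSingletonClass 𝒜] {m : MeasurableSpace Ω}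
    {t : ℕ} (hA : Measurable (A t)) (hY : Measurable (Y t)) : Measurable (observation Y A t) := by
  have h_eval : Measurable fun p : (𝒜 → 𝒴) × 𝒜 => p.1 p.2 :=
    measurable_from_prod_countable_left measurable_pi_apply
  exact hA.prodMk (h_eval.comp (hY.prodMk hA))

theorem comap_observation_le_history {s t : ℕ} (hst : s < t) :
    .comap (observation Y A s) inferInstance ≤ history Y A t :=
  le_iSup (fun r : Fin t => MeasurableSpace.comap (observation Y A r) inferInstance) ⟨s, hst⟩

theorem history_zero : history Y A 0 = ⊥ :=
  iSup_of_empty _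

theorem history_succ (t : ℕ) :
    history Y A (t + 1) = history Y A t ⊔ .comap (observation Y A t) inferInstance := by
  refine le_antisymm (iSup_le fun s => ?_) (sup_le (iSup_le fun s => ?_) ?_)
  · rcases Nat.lt_succ_iff_lt_or_eq.1 s.2 with hs | hs
    · exact (comap_observation_le_history hs).trans le_sup_left
    · rw [hs]
      exact le_sup_right
  · exact comap_observation_le_history (s.2.trans t.lt_succ_self)
  · exact comap_observation_le_history t.lt_succ_self

end History

section InformationBudget

variable {Ω 𝒜 𝒴 : Type*} [mΩ : MeasurableSpace Ω] [MeasurableSpace 𝒜] [MeasurableSpace 𝒴]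
  [Fintype 𝒜] {μ : Measure Ω} [IsFiniteMeasure μ] {Y : ℕ → Ω → 𝒜 → 𝒴} {R : 𝒴 → ℝ}
  {A : ℕ → Ω → 𝒜} {X : Ω → 𝒜}

theorem integrable_posteriorMutualInfo {t : ℕ} (hH : history Y A t ≤ mΩ)
    (hX : ∀ a, MeasurableSet (X ⁻¹' {a})) :
    Integrable (posteriorMutualInfo (history Y A t) μ X (observation Y A t)) μ :=
  (integrable_posteriorEntropy hH hX).sub integrable_condExp

theorem integral_posteriorMutualInfo {t : ℕ} (hH : history Y A t ≤ mΩ)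
    (hX : ∀ a, MeasurableSet (X ⁻¹' {a})) :
    ∫ ω, posteriorMutualInfo (history Y A t) μ X (observation Y A t) ω ∂μ =
      ∫ ω, posteriorEntropy (history Y A t) μ X ω ∂μ -
        ∫ ω, posteriorEntropy (history Y A (t + 1)) μ X ω ∂μ := by
  simp only [posteriorMutualInfo, posteriorCondEntropy]
  rw [integral_sub (integrable_posteriorEntropy hH hX) integrable_condExp, integral_condExp hH,
    ← history_succ]

theorem sum_integral_posteriorMutualInfo_le [IsProbabilityMeasure μ]
    (hH : ∀ t, history Y A t ≤ mΩ) (hX : ∀ a, MeasurableSet (X ⁻¹' {a})) (T : ℕ) :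
    ∑ t ∈ Finset.range T,
      ∫ ω, posteriorMutualInfo (history Y A t) μ X (observation Y A t) ω ∂μ ≤ entropy μ X := by
  simp only [integral_posteriorMutualInfo (hH _) hX]
  rw [Finset.sum_range_sub', history_zero, posteriorEntropy_bot hX, integral_const,
    probReal_univ, one_smul]
  exact sub_le_self _ (integral_nonneg_of_ae (posteriorEntropy_nonneg hX))

theorem sq_integral_le_of_sq_condExp_le [IsProbabilityMeasure μ] {F : MeasurableSpace Ω}
    (hF : F ≤ mΩ) {f g : Ω → ℝ} (hg : Integrable g μ) (h : ∀ᵐ ω ∂μ, (μ[f | F]) ω ^ 2 ≤ g ω) :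
    (∫ ω, f ω ∂μ) ^ 2 ≤ ∫ ω, g ω ∂μ := by
  have h_tangent : ∫ ω, (2 * (∫ ω, f ω ∂μ) * (μ[f | F]) ω - (∫ ω, f ω ∂μ) ^ 2) ∂μ ≤
      ∫ ω, g ω ∂μ := by
    refine integral_mono_ae ((integrable_condExp.const_mul _).sub (integrable_const _)) hg ?_
    filter_upwards [h] with ω hω
    linarith [sq_nonneg ((μ[f | F]) ω - ∫ ω, f ω ∂μ)]
  rw [integral_sub (integrable_condExp.const_mul _) (integrable_const _), integral_const_mul,
    integral_condExp hF, integral_const, probReal_univ, one_smul] at h_tangent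
  linarith

theorem integral_regret_le [IsProbabilityMeasure μ] (hH : ∀ t, history Y A t ≤ mΩ)
    (hX : ∀ a, MeasurableSet (X ⁻¹' {a})) {K : ℝ} (hK : 0 ≤ K)
    (hint : ∀ t, Integrable (instantRegret Y R A X t) μ)
    (hratio : ∀ t, ∀ᵐ ω ∂μ, (μ[instantRegret Y R A X t | history Y A t]) ω ^ 2 ≤
      K * posteriorMutualInfo (history Y A t) μ X (observation Y A t) ω) (T : ℕ) :
    ∫ ω, regret Y R A X T ω ∂μ ≤ √(K * entropy μ X * T) := by
  set ρ : ℕ → ℝ := fun t => ∫ ω, instantRegret Y R A X t ω ∂μ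
  have h_sq : ∀ t, ρ t ^ 2 ≤
      K * ∫ ω, posteriorMutualInfo (history Y A t) μ X (observation Y A t) ω ∂μ := fun t => by
    rw [← integral_const_mul]
    exact sq_integral_le_of_sq_condExp_le (hH t)
      ((integrable_posteriorMutualInfo (hH t) hX).const_mul K) (hratio t)
  have h_sum : ∫ ω, regret Y R A X T ω ∂μ = ∑ t ∈ Finset.range T, ρ t :=
    integral_finsetSum _ fun t _ => hint t
  rw [h_sum]
  refine Real.le_sqrt_of_sq_le ?_
  calc (∑ t ∈ Finset.range T, ρ t) ^ 2
      ≤ T * ∑ t ∈ Finset.range T, ρ t ^ 2 := by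
        simpa only [Finset.card_range] using
          sq_sum_le_card_mul_sum_sq (s := Finset.range T) (f := ρ)
    _ ≤ T * ∑ t ∈ Finset.range T,
          K * ∫ ω, posteriorMutualInfo (history Y A t) μ X (observation Y A t) ω ∂μ := by
        gcongr with t
        exact h_sq t
    _ ≤ T * (K * entropy μ X) := by
        rw [← Finset.mul_sum]
        gcongr
        exact sum_integral_posteriorMutualInfo_le hH hX T
    _ = K * entropy μ X * T := mul_comm _ _

end InformationBudget

section Policy

variable {Ω 𝒜 𝒴 𝒰 : Type*} [MeasurableSpace 𝒜] [MeasurableSpace 𝒴] [MeasurableSpace 𝒰]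

/-- Everything the external randomness of period `t` is independent of, including a target
action `X` in the role of the optimal one. -/
def environment (Y : ℕ → Ω → 𝒜 → 𝒴) (U : ℕ → Ω → 𝒰) (X : Ω → 𝒜) (t : ℕ) (ω : Ω) :
    ({s : ℕ // s ≠ t} → 𝒰) × (ℕ → 𝒜 → 𝒴) × 𝒜 :=
  (fun s : {s : ℕ // s ≠ t} => U s ω, fun s => Y s ω, X ω)

variable {Y : ℕ → Ω → 𝒜 → 𝒴} {U : ℕ → Ω → 𝒰} {A : ℕ → Ω → 𝒜} {X : Ω → 𝒜}

theorem measurable_environment {_ : MeasurableSpace Ω} {t : ℕ}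
    (hU : ∀ s, s ≠ t → Measurable (U s)) (hY : ∀ s, Measurable (Y s)) (hX : Measurable X) :
    Measurable (environment Y U X t) :=
  (measurable_pi_lambda _ fun s : {s : ℕ // s ≠ t} => hU s s.2).prodMk
    ((measurable_pi_lambda _ hY).prodMk hX)

theorem measurable_noise_comap_environment {s t : ℕ} (hst : s ≠ t) :
    Measurable[.comap (environment Y U X t) inferInstance] (U s) :=
  (measurable_pi_apply (⟨s, hst⟩ : {s : ℕ // s ≠ t})).comp
    (measurable_fst.comp (comap_measurable (environment Y U X t)))

theorem measurable_outcome_comap_environment (s t : ℕ) :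
    Measurable[.comap (environment Y U X t) inferInstance] (Y s) :=
  (measurable_pi_apply s).comp
    (measurable_fst.comp (measurable_snd.comp (comap_measurable (environment Y U X t))))

theorem measurable_target_comap_environment (t : ℕ) :
    Measurable[.comap (environment Y U X t) inferInstance] X :=
  measurable_snd.comp (measurable_snd.comp (comap_measurable (environment Y U X t)))

variable [mΩ : MeasurableSpace Ω] {μ : Measure Ω}

/-- The actions `A` are chosen from the history and fresh noise `U`, as in `IsBanditModel`, but the
outcomes `Y` and the target action `X` have an arbitrary joint law. -/
structure IsRandomizedPolicy (μ : Measure Ω) (Y : ℕ → Ω → 𝒜 → 𝒴) (U : ℕ → Ω → 𝒰)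
    (A : ℕ → Ω → 𝒜) (X : Ω → 𝒜) : Prop where
  measurable_outcome : ∀ t, Measurable (Y t)
  measurable_noise : ∀ t, Measurable (U t)
  measurable_target : Measurable X
  indep_noise : ∀ t, IndepFun (U t) (environment Y U X t) μ
  measurable_action : ∀ t, Measurable[history Y A t ⊔ .comap (U t) inferInstance] (A t)

theorem IsBanditModel.isRandomizedPolicy [Fintype 𝒜] {pstar : Ω → ProbabilityMeasure (𝒜 → 𝒴)}
    {R : 𝒴 → ℝ} (h : IsBanditModel μ pstar Y R U A X) : IsRandomizedPolicy μ Y U A X where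
  measurable_outcome := h.measurable_outcome
  measurable_noise := h.measurable_noise
  measurable_target := h.measurable_optimal.mono h.measurable_pstar.comap_le le_rfl
  measurable_action := h.measurable_action
  indep_noise t := by
    let E : Ω → ({s : ℕ // s ≠ t} → 𝒰) × (ℕ → 𝒜 → 𝒴) × ProbabilityMeasure (𝒜 → 𝒴) := fun ω =>
      (fun s : {s : ℕ // s ≠ t} => U s ω, fun s => Y s ω, pstar ω)
    have h_env : Measurable[.comap E inferInstance] E := comap_measurable E
    refine indep_of_indep_of_le_right (h.indep_noise t) (measurable_environment
      (fun s hs => (measurable_pi_apply (⟨s, hs⟩ : {s : ℕ // s ≠ t})).comp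
        (measurable_fst.comp h_env))
      (fun s => (measurable_pi_apply s).comp (measurable_fst.comp (measurable_snd.comp h_env)))
      (h.measurable_optimal.mono
        (measurable_snd.comp (measurable_snd.comp h_env)).comap_le le_rfl)).comap_le

namespace IsRandomizedPolicy

theorem comap_environment_le (h : IsRandomizedPolicy μ Y U A X) (t : ℕ) :
    .comap (environment Y U X t) inferInstance ≤ mΩ :=
  (measurable_environment (fun s _ => h.measurable_noise s) h.measurable_outcome
    h.measurable_target).comap_le

variable [Countable 𝒜] [MeasurableSingletonClass 𝒜]

theorem history_le_comap_environment (h : IsRandomizedPolicy μ Y U A X) {s t : ℕ} (hst : s ≤ t) :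
    history Y A s ≤ .comap (environment Y U X t) inferInstance := by
  induction s with
  | zero => exact history_zero.trans_le bot_le
  | succ s ih =>
    have h_action : Measurable[.comap (environment Y U X t) inferInstance] (A s) :=
      (h.measurable_action s).mono (sup_le (ih (Nat.le_of_succ_le hst))
        (measurable_noise_comap_environment (Nat.ne_of_lt hst)).comap_le) le_rfl
    rw [history_succ]
    exact sup_le (ih (Nat.le_of_succ_le hst))
      (measurable_observation h_action (measurable_outcome_comap_environment s t)).comap_le

theorem history_le (h : IsRandomizedPolicy μ Y U A X) (t : ℕ) : history Y A t ≤ mΩ :=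
  (h.history_le_comap_environment le_rfl).trans (h.comap_environment_le t)

theorem measurable_chosen (h : IsRandomizedPolicy μ Y U A X) (t : ℕ) : Measurable (A t) :=
  (h.measurable_action t).mono (sup_le (h.history_le t) (h.measurable_noise t).comap_le) le_rfl

end IsRandomizedPolicy

end Policy

section Items

variable {Ω : Type*} {d : ℕ} {𝒜 : Finset (Finset (Fin d))} {θ : ℕ → Fin d → Ω → ℝ}

/-- The value of item `i` in an outcome, zero if the item does not appear. -/
def itemValue (i : Fin d) (y : ItemOutcome d) : ℝ :=
  if h : i ∈ y.1 then y.2 ⟨i, h⟩ else 0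

theorem measurable_itemValue (i : Fin d) : Measurable (itemValue i) := by
  intro s hs
  refine MeasurableSpace.measurableSet_iInf.2 fun a => ?_
  have h_fiber : Measurable fun v : a → ℝ => itemValue i ⟨a, v⟩ := by
    by_cases h : i ∈ a
    · simpa only [itemValue, h, dite_true] using measurable_pi_apply (⟨i, h⟩ : a)
    · simpa only [itemValue, h, dite_false] using measurable_const
  exact h_fiber hs

theorem itemValue_itemOutcome (t : ℕ) (ω : Ω) (a : 𝒜) (i : Fin d) :
    itemValue i (itemOutcome θ t ω a) = if i ∈ a.1 then θ t i ω else 0 := by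
  by_cases h : i ∈ a.1 <;> simp [itemValue, itemOutcome, h]

theorem itemReward_itemOutcome (m t : ℕ) (ω : Ω) (a : 𝒜) :
    itemReward m (itemOutcome θ t ω a) = (1 / (m : ℝ)) * ∑ i ∈ a.1, θ t i ω := by
  rw [itemReward, itemOutcome, ← Finset.sum_coe_sort a.1 fun i => θ t i ω]

theorem instantRegret_itemOutcome (m t : ℕ) (A : ℕ → Ω → 𝒜) (X : Ω → 𝒜) :
    instantRegret (itemOutcome θ) (itemReward m) A X t = (1 / (m : ℝ)) • fun ω =>
      ∑ i ∈ (X ω).1, θ t i ω - ∑ i ∈ (A t ω).1, θ t i ω := by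
  ext ω
  simp only [instantRegret, itemReward_itemOutcome, Pi.smul_apply, smul_eq_mul, mul_sub]

theorem measurable_item_of_measurable_itemOutcome {m : MeasurableSpace Ω} {t : ℕ}
    (h : Measurable (itemOutcome (𝒜 := 𝒜) θ t)) (a : 𝒜) {i : Fin d} (hi : i ∈ a.1) :
    Measurable (θ t i) := by
  have h_value := (measurable_itemValue i).comp ((measurable_pi_apply a).comp h)
  simpa only [Function.comp_def, itemValue_itemOutcome, hi, if_true] using h_value

theorem measurable_observed_item (A : ℕ → Ω → 𝒜) (t : ℕ) (i : Fin d) :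
    Measurable[.comap (observation (itemOutcome θ) A t) inferInstance]
      fun ω => if i ∈ (A t ω).1 then θ t i ω else 0 := by
  have h_obs : Measurable[.comap (observation (itemOutcome θ) A t) inferInstance]
      (observation (itemOutcome θ) A t) := comap_measurable _
  have h_value := (measurable_itemValue i).comp (measurable_snd.comp h_obs)
  simpa only [Function.comp_def, observation, itemValue_itemOutcome] using h_value

end Items

section SemiBanditRegret

variable {Ω 𝒰 : Type*} [MeasurableSpace Ω] [MeasurableSpace 𝒰] {μ : Measure Ω}
  [IsFiniteMeasure μ] {d m t : ℕ} {𝒜 : Finset (Finset (Fin d))} {θ : ℕ → Fin d → Ω → ℝ}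
  {U : ℕ → Ω → 𝒰} {A : ℕ → Ω → 𝒜} {X : Ω → 𝒜} {lo hi : Fin d → ℝ}

theorem integrable_instantRegret_itemOutcome (hA : Measurable (A t)) (hX : Measurable X)
    (hθ : ∀ i, Measurable (θ t i)) (hbdd : ∀ i, ∀ᵐ ω ∂μ, θ t i ω ∈ Set.Icc (lo i) (hi i)) :
    Integrable (instantRegret (itemOutcome θ) (itemReward m) A X t) μ := by
  rw [instantRegret_itemOutcome]
  exact (integrable_sum_sub_sum (S := fun a : 𝒜 => a.1) (fun a => hA (.singleton a))
    (fun a => hX (.singleton a)) fun i =>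
      Integrable.of_mem_Icc (lo i) (hi i) (hθ i).aemeasurable (hbdd i)).smul _

theorem sq_condExp_sum_sub_sum_itemOutcome_le
    (h : IsRandomizedPolicy μ (itemOutcome θ) U A X)
    (hTS : IsThompsonSampling μ (itemOutcome θ) A X) (hθ : ∀ i, Measurable (θ t i))
    (hbdd : ∀ i, ∀ᵐ ω ∂μ, θ t i ω ∈ Set.Icc (lo i) (hi i))
    (hindep : CondIndepGiven (history (itemOutcome θ) A t) μ (θ t)) :
    ∀ᵐ ω ∂μ, (μ[fun ω => ∑ i ∈ (X ω).1, θ t i ω - ∑ i ∈ (A t ω).1, θ t i ω |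
        history (itemOutcome θ) A t]) ω ^ 2 ≤
      (∑ i, (hi i - lo i) ^ 2) / 2 * posteriorMutualInfo (history (itemOutcome θ) A t) μ X
        (observation (itemOutcome θ) A t) ω :=
  sq_condExp_sum_sub_sum_le (S := fun a : 𝒜 => a.1) (h.history_le_comap_environment le_rfl)
    (h.comap_environment_le t) (h.measurable_noise t).comap_le (h.indep_noise t)
    (h.measurable_action t) (measurable_target_comap_environment t) (hTS t)
    (fun a _ hi => measurable_item_of_measurable_itemOutcome
      (measurable_outcome_comap_environment t t) a hi)
    hθ hbdd hindep (measurable_observation (h.measurable_chosen t) (h.measurable_outcome t))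
    (measurable_fst.comp (comap_measurable (observation (itemOutcome θ) A t)))
    (measurable_observed_item A t)

theorem sq_condExp_instantRegret_le (hm : 1 ≤ m) (h : IsRandomizedPolicy μ (itemOutcome θ) U A X)
    (hTS : IsThompsonSampling μ (itemOutcome θ) A X) (hθ : ∀ i, Measurable (θ t i))
    (hbdd : ∀ i, ∀ᵐ ω ∂μ, θ t i ω ∈ Set.Icc (lo i) (hi i))
    (hindep : CondIndepGiven (history (itemOutcome θ) A t) μ (θ t)) :
    ∀ᵐ ω ∂μ, (μ[instantRegret (itemOutcome θ) (itemReward m) A X t |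
        history (itemOutcome θ) A t]) ω ^ 2 ≤
      (∑ i, (hi i - lo i) ^ 2) / (2 * (m : ℝ) ^ 2) *
        posteriorMutualInfo (history (itemOutcome θ) A t) μ X
          (observation (itemOutcome θ) A t) ω := by
  have : (0 : ℝ) < m := by exact_mod_cast hm
  rw [instantRegret_itemOutcome]
  filter_upwards [sq_condExp_sum_sub_sum_itemOutcome_le h hTS hθ hbdd hindep,
    condExp_smul (μ := μ) (1 / (m : ℝ))
      (fun ω => ∑ i ∈ (X ω).1, θ t i ω - ∑ i ∈ (A t ω).1, θ t i ω)
      (history (itemOutcome θ) A t)] with ω h_sq h_smul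
  rw [h_smul, Pi.smul_apply, smul_eq_mul, mul_pow, div_mul_eq_mul_div, le_div_iff₀ (by positivity)]
  field_simp at h_sq ⊢
  linarith

end SemiBanditRegret

section InformationRatio

variable {Ω 𝒜 𝒴 : Type*} [MeasurableSpace Ω] [MeasurableSpace 𝒜] [MeasurableSpace 𝒴] [Fintype 𝒜]
  {μ : Measure Ω} {Y : ℕ → Ω → 𝒜 → 𝒴} {R : 𝒴 → ℝ} {A : ℕ → Ω → 𝒜} {X : Ω → 𝒜}

theorem informationRatio_le_ofReal {t : ℕ} {ω : Ω} {K : ℝ} (hK : 0 ≤ K)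
    (h : (μ[instantRegret Y R A X t | history Y A t]) ω ^ 2 ≤
      K * posteriorMutualInfo (history Y A t) μ X (observation Y A t) ω) :
    informationRatio μ Y R A X t ω ≤ ENNReal.ofReal K := by
  refine ENNReal.div_le_of_le_mul ?_
  rw [← ENNReal.ofReal_mul hK]
  exact ENNReal.ofReal_le_ofReal h

end InformationRatio

end Bandit

theorem proposition6_general {Ω 𝒰 : Type*} [MeasurableSpace Ω] [MeasurableSpace 𝒰]
    (μ : Measure Ω) [IsProbabilityMeasure μ]
    (d m : ℕ) (hm : 1 ≤ m) (𝒜 : Finset (Finset (Fin d)))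
    (θ : ℕ → Fin d → Ω → ℝ) (hθ : ∀ t i, Measurable (θ t i)) (lo hi : Fin d → ℝ)
    (hθ_bdd : ∀ t i, ∀ᵐ ω ∂μ, θ t i ω ∈ Set.Icc (lo i) (hi i))
    (U : ℕ → Ω → 𝒰) (A : ℕ → Ω → 𝒜) (X : Ω → 𝒜)
    (hpolicy : IsRandomizedPolicy μ (itemOutcome θ) U A X)
    (hTS : IsThompsonSampling μ (itemOutcome θ) A X)
    (hindep : ∀ t, CondIndepGiven (history (itemOutcome θ) A t) μ (θ t)) :
    (∀ t, ∀ᵐ ω ∂μ, informationRatio μ (itemOutcome θ) (itemReward m) A X t ω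
        ≤ ENNReal.ofReal ((∑ i, (hi i - lo i) ^ 2) / (2 * (m : ℝ) ^ 2))) ∧
    (∀ T : ℕ, ∫ ω, regret (itemOutcome θ) (itemReward m) A X T ω ∂μ
        ≤ (1 / (m : ℝ)) * √((∑ i, (hi i - lo i) ^ 2) * entropy μ X * T / 2)) := by
  have hK : 0 ≤ (∑ i, (hi i - lo i) ^ 2) / (2 * (m : ℝ) ^ 2) := by positivity
  have h_sq := fun t => sq_condExp_instantRegret_le hm hpolicy hTS (hθ t) (hθ_bdd t) (hindep t)
  refine ⟨fun t => (h_sq t).mono fun ω hω => informationRatio_le_ofReal hK hω, fun T => ?_⟩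
  calc ∫ ω, regret (itemOutcome θ) (itemReward m) A X T ω ∂μ
      ≤ √((∑ i, (hi i - lo i) ^ 2) / (2 * (m : ℝ) ^ 2) * entropy μ X * T) :=
        integral_regret_le hpolicy.history_le (fun a => hpolicy.measurable_target (.singleton a)) hK
          (fun t => integrable_instantRegret_itemOutcome (hpolicy.measurable_chosen t)
            hpolicy.measurable_target (hθ t) (hθ_bdd t)) h_sq T
    _ = √((1 / (m : ℝ)) ^ 2 * ((∑ i, (hi i - lo i) ^ 2) * entropy μ X * T / 2)) := by
        congr 1
        field_simp
    _ = (1 / (m : ℝ)) * √((∑ i, (hi i - lo i) ^ 2) * entropy μ X * T / 2) := by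
        rw [Real.sqrt_mul (sq_nonneg _), Real.sqrt_sq (by positivity)]

theorem proposition6 {Ω 𝒰 : Type*} [MeasurableSpace Ω] [MeasurableSpace 𝒰]
    (μ : Measure Ω) [IsProbabilityMeasure μ]
    (d m : ℕ) (hm : 1 ≤ m)
    (𝒜 : Finset (Finset (Fin d))) (h𝒜 : ∀ a ∈ 𝒜, a.card ≤ m)
    (θ : ℕ → Fin d → Ω → ℝ) (hθ : ∀ t i, Measurable (θ t i))
    (hθ_bdd : ∀ t i, ∀ᵐ ω ∂μ, θ t i ω ∈ Set.Icc (-1 / 2 : ℝ) (1 / 2))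
    (pstar : Ω → ProbabilityMeasure (𝒜 → ItemOutcome d))
    (U : ℕ → Ω → 𝒰) (A : ℕ → Ω → 𝒜) (Astar : Ω → 𝒜)
    (hmodel : IsBanditModel μ pstar (itemOutcome θ) (itemReward m) U A Astar)
    (hTS : IsThompsonSampling μ (itemOutcome θ) A Astar)
    (hindep : ∀ t, CondIndepGiven (history (itemOutcome θ) A t) μ (θ t)) :
    (∀ t, ∀ᵐ ω ∂μ, informationRatio μ (itemOutcome θ) (itemReward m) A Astar t ω
        ≤ ENNReal.ofReal ((d : ℝ) / (2 * (m : ℝ) ^ 2))) ∧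
    (∀ T : ℕ, ∫ ω, regret (itemOutcome θ) (itemReward m) A Astar T ω ∂μ
        ≤ (1 / (m : ℝ)) * Real.sqrt ((d : ℝ) * entropy μ Astar * (T : ℝ))) := by
  have h_width : (∑ _i : Fin d, ((1 / 2 : ℝ) - -1 / 2) ^ 2 : ℝ) = d := by norm_num
  obtain ⟨h_ratio, h_regret⟩ := proposition6_general μ d m hm 𝒜 θ hθ (fun _ => -1 / 2)
    (fun _ => 1 / 2) hθ_bdd U A Astar hmodel.isRandomizedPolicy hTS hindep
  simp only [h_width] at h_ratio h_regret
  refine ⟨h_ratio, fun T => (h_regret T).trans ?_⟩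
  gcongr
  exact half_le_self (mul_nonneg (mul_nonneg d.cast_nonneg entropy_nonneg) T.cast_nonneg)
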